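/- **Theorem.** The emptiness problem for realtime private alternating finite automata is undecidable: there is no algorithm that, given (a finite description of) a realtime private alternating finite automaton $M$, decides whether $L(M)=\emptyset$. Here a *realtime private alternating finite automaton* (PAFA) is a tuple $M=(S_c,S_p,\Sigma,U,\delta_E,\delta_U,s_{c0},s_{p0},q_a,q_r,\Gamma,\Delta)$, where $S_c$, $S_p$ are finite sets (common and private state components), $\Sigma$ is a finite input alphabet with an end-marker $\#\notin\Sigma$, $\Gamma$ and $\Delta$ are disjoint finite sets (public and private game alphabets) with at least two symbols each, $U\subseteq S_c\times S_p$ is the set of universal states (the other states in $S_c\times S_p$ are existential), $s_{c0}\in S_c$, $s_{p0}\in S_p$, $q_a,q_r\in S_c$, and $\delta_E:S_c\to\mathcal P(S_c)$, $\delta_U:S_c\times S_p\times(\Sigma\cup\{\#\})\to\mathcal P(S_c\times S_p)$ are such that: * every value of $\delta_E$ is either a singleton or a set of $|\Gamma|$ elements, labelled bijectively by $\Gamma$; * every value of $\delta_U$ is either a singleton or a set of $|\Gamma\cup\Delta|$ elements, labelled bijectively by $\Gamma\cup\Delta$, and in the latter case the elements of $\delta_U(s_c,s_p,\sigma)$ labelled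 by symbols of $\Gamma$ have private component $s_p$. A transition from an existential state $(s_c,s_p)$ leads to some $(s_c',s_p)$ with $s_c'\in\delta_E(s_c)$; a transition from a universal state $(s_c,s_p)$ while scanning $\sigma$ leads to some element of $\delta_U(s_c,s_p,\sigma)$. On an input $w\in\Sigma^*$ of length $n$ the tape contains $\# w\#$, and $M$ makes exactly two transitions on each of the $n+2$ tape symbols, from left to right. The *computation tree* of $M$ on $w$ is the resulting tree of depth $2n+4$, whose root is labelled $(s_{c0},s_{p0})$ and whose nodes correspond to the sequences of transitions from the root. The *public moves seen by* a node is the string in $\Gamma^*$ of the labels in $\Gamma$ of the transitions, made from existential or universal states, on the path from the root to this node (a transition from a state with a single successor carries no label). The automaton $M$ *accepts* $w$ if the computation tree has a subtree that contains the root, exactly one child of each of its existential nodes and all children of each of its universal nodes (at levels below $2n+4$), in which all nodes at level $2n+4$ have common state component $q_a$, and in which any two existential nodes (possibly at different levels) with the same common state component that have seen the same public moves make the same move, i.e. proceed by equally labelled (or both unlabelled) transitions. $L(M)$ is the set of all $w\in\Sigma^*$ accepted by $M$. -/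

import Mathlib

/-- The value of a transition function: either a single successor, or one successor for each
label in `L`, distinct labels leading to distinct successors. -/
inductive LabelledMove (L α : Type) : Type
  | single (t : α) : LabelledMove L α
  | choice (f : L ↪ α) : LabelledMove L α

/-- A realtime private alternating finite automaton with common state components `C`, private
state components `P`, input alphabet `A`, public game alphabet `G` and private game alphabet `D`.
The disjoint union of the two game alphabets is `G ⊕ D`; a tape symbol is an element of
`Option A`, with `none` for the end-marker. -/
structure PAFA (C P A G D : Type) [Finite C] [Finite P] [Finite A] [Finite G] [Finite D] where
  /-- `(c, p)` is a universal state if the value is `true`, an existential one otherwise. -/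
  isUniversal : C → P → Bool
  /-- The existential transition function: it sees and changes only the common component. -/
  deltaE : C → LabelledMove G C
  /-- The universal transition function. -/
  deltaU : C → P → Option A → LabelledMove (G ⊕ D) (C × P)
  initC : C
  initP : P
  accept : C
  reject : C
  public_nontrivial : Nontrivial G
  private_nontrivial : Nontrivial D
  /-- A public move of the universal player leaves the private component unchanged. -/
  public_move : ∀ c p a f, deltaU c p a = .choice f → ∀ g : G, (f (Sum.inl g)).2 = p

namespace PAFA

variable {C P A G D : Type} [Finite C] [Finite P] [Finite A] [Finite G] [Finite D]

/-- The tape content for the input `w`: the word `w` between two end-markers. -/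
def tape (w : List A) : List (Option A) :=
  none :: (w.map some ++ [none])

/-- The depth of the computation tree: two transitions for each tape symbol. -/
def depth (w : List A) : ℕ :=
  2 * (tape w).length

/-- The symbol scanned at a node of level `i < depth w`. -/
def scanned (w : List A) (i : ℕ) : Option A :=
  (tape w).getD (i / 2) none

/-- An edge of the computation tree: the label of the move (`none` if the state has a single
successor, which is no move of the game) and the state that is reached. -/
abbrev Edge (C P G D : Type) : Type := Option (G ⊕ D) × (C × P)

/-- A node of the computation tree, given by the edges on the path to it from the root, the most
recent edge first. Its level is the length of the list. -/
abbrev Node (C P G D : Type) : Type := List (Edge C P G D)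

/-- The state that labels a node. -/
def state (M : PAFA C P A G D) : Node C P G D → C × P
  | [] => (M.initC, M.initP)
  | e :: _ => e.2

/-- `M.Step s a e`: from the state `s`, scanning the tape symbol `a`, there is the edge `e`. -/
def Step (M : PAFA C P A G D) (s : C × P) (a : Option A) (e : Edge C P G D) : Prop :=
  match M.isUniversal s.1 s.2 with
  | true =>
    match M.deltaU s.1 s.2 a with
    | .single t => e = (none, t)
    | .choice f => ∃ l : G ⊕ D, e = (some l, f l)
  | false =>
    match M.deltaE s.1 with
    | .single c => e = (none, (c, s.2))
    | .choice f => ∃ g : G, e = (some (Sum.inl g), (f g, s.2))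

/-- The computation tree on the input `w`, as the set of its nodes. -/
inductive ComputationTree (M : PAFA C P A G D) (w : List A) : Node C P G D → Prop
  | root : ComputationTree M w []
  | child (N : Node C P G D) (e : Edge C P G D) :
      ComputationTree M w N → N.length < depth w →
      M.Step (M.state N) (scanned w N.length) e → ComputationTree M w (e :: N)

/-- The node is labelled by a universal state. -/
def IsUniversalNode (M : PAFA C P A G D) (N : Node C P G D) : Prop :=
  M.isUniversal (M.state N).1 (M.state N).2 = true

/-- The public symbol of an edge, if its label belongs to the public game alphabet. -/
def publicLabel (e : Edge C P G D) : Option G :=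
  e.1.bind Sum.getLeft?

/-- The public moves seen by a node: the string of all moves, of either player, that are made on
the path from the root to the node and are named by a symbol of the public game alphabet. -/
def publicMoves (N : Node C P G D) : List G :=
  N.reverse.filterMap publicLabel

/-- `T` is an accepting computation subtree on the input `w`. -/
structure IsAcceptingSubtree (M : PAFA C P A G D) (w : List A) (T : Set (Node C P G D)) :
    Prop where
  subset : ∀ N ∈ T, M.ComputationTree w N
  root_mem : [] ∈ T
  parent_mem : ∀ N e, e :: N ∈ T → N ∈ T
  /-- exactly one child of every existential inner node -/
  existential : ∀ N ∈ T, N.length < depth w → ¬ M.IsUniversalNode N → ∃! e, e :: N ∈ T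
  /-- all children of every universal inner node -/
  universal : ∀ N ∈ T, M.IsUniversalNode N →
    ∀ e, M.ComputationTree w (e :: N) → e :: N ∈ T
  /-- all leaves are accepting -/
  leaf : ∀ N ∈ T, N.length = depth w → (M.state N).1 = M.accept
  /-- Two existential nodes, possibly of different levels, with the same common state component
  that have seen the same public moves make the same move. -/
  privacy : ∀ N₁ N₂ e₁ e₂, e₁ :: N₁ ∈ T → e₂ :: N₂ ∈ T →
    ¬ M.IsUniversalNode N₁ → ¬ M.IsUniversalNode N₂ →
    (M.state N₁).1 = (M.state N₂).1 → publicMoves N₁ = publicMoves N₂ → e₁.1 = e₂.1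

/-- The language recognized by the automaton. -/
def language (M : PAFA C P A G D) : Set (List A) :=
  {w | ∃ T, M.IsAcceptingSubtree w T}

end PAFA

/-! Finite descriptions of automata, the instances of decision problems. -/

/-- The type of finite descriptions: the sizes of the five finite sets; the table of universal
states; the tables of the two transition functions, each value being written as the list of the
successor states; and the initial components and the accepting and rejecting components. -/
abbrev PAFADescription : Type :=
  (ℕ × ℕ × ℕ × ℕ × ℕ) × List (List Bool) × List (List ℕ) ×
    List (List (List (List (ℕ × ℕ)))) × (ℕ × ℕ × ℕ × ℕ)

namespace PAFA

variable {nC nP nA nG nD : ℕ}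

/-- A value of the existential transition function as a list, in the order of the labels. -/
def describeE : LabelledMove (Fin nG) (Fin nC) → List ℕ
  | .single c => [(c : ℕ)]
  | .choice f => List.ofFn fun g => (f g : ℕ)

/-- A value of the universal transition function as a list, in the order of the labels,
public labels first. -/
def describeU : LabelledMove (Fin nG ⊕ Fin nD) (Fin nC × Fin nP) → List (ℕ × ℕ)
  | .single t => [((t.1 : ℕ), (t.2 : ℕ))]
  | .choice f =>
      (List.ofFn fun g => (((f (Sum.inl g)).1 : ℕ), ((f (Sum.inl g)).2 : ℕ))) ++
        List.ofFn fun d => (((f (Sum.inr d)).1 : ℕ), ((f (Sum.inr d)).2 : ℕ))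

/-- The finite description of an automaton whose sets are initial segments of `ℕ`. -/
def describe (M : PAFA (Fin nC) (Fin nP) (Fin nA) (Fin nG) (Fin nD)) : PAFADescription :=
  ((nC, nP, nA, nG, nD),
    (List.ofFn fun c => List.ofFn fun p => M.isUniversal c p),
    (List.ofFn fun c => describeE (M.deltaE c)),
    (List.ofFn fun c => List.ofFn fun p =>
      describeU (M.deltaU c p none) ::
        List.ofFn fun a => describeU (M.deltaU c p (some a))),
    ((M.initC : ℕ), (M.initP : ℕ), (M.accept : ℕ), (M.reject : ℕ)))

theorem describeE_inj (h : 2 ≤ nG) : Function.Injective (describeE (nG := nG) (nC := nC)) := by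
  intro x y hxy
  cases x with
  | single a => cases y with
    | single b => simp [describeE] at hxy; rw [Fin.ext hxy]
    | choice f => have := congrArg List.length hxy; simp [describeE] at this; omega
  | choice f => cases y with
    | single b => have := congrArg List.length hxy; simp [describeE] at this; omega
    | choice f' =>
      have := List.ofFn_injective hxy
      congr 1; ext g; exact congrFun this g

theorem describeU_inj (h : 2 ≤ nG) :
    Function.Injective (describeU (nG := nG) (nC := nC) (nP := nP) (nD := nD)) := by
  intro x y hxy
  cases x with
  | single a => cases y with
    | single b => simp [describeU] at hxy; rw [Prod.ext (Fin.ext hxy.1) (Fin.ext hxy.2)]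
    | choice f => have := congrArg List.length hxy; simp [describeU] at this; omega
  | choice f => cases y with
    | single b => have := congrArg List.length hxy; simp [describeU] at this; omega
    | choice f' =>
      simp only [describeU] at hxy
      obtain ⟨h1, h2⟩ := List.append_inj hxy (by simp)
      have h1 := List.ofFn_injective h1
      have h2 := List.ofFn_injective h2
      congr 1; ext l
      all_goals rcases l with g | g
      all_goals first
        | exact (Prod.ext_iff.1 (congrFun h1 g)).1
        | exact (Prod.ext_iff.1 (congrFun h2 g)).1
        | exact (Prod.ext_iff.1 (congrFun h1 g)).2
        | exact (Prod.ext_iff.1 (congrFun h2 g)).2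

/-- An automaton is determined by its description. -/
theorem describe_injective :
    Function.Injective (describe (nC := nC) (nP := nP) (nA := nA) (nG := nG) (nD := nD)) := by
  intro M N h
  have h2 : 2 ≤ nG := Fin.nontrivial_iff_two_le.1 M.public_nontrivial
  simp only [describe, Prod.mk.injEq, List.ofFn_inj, true_and] at h
  obtain ⟨hu, he, hU, h3⟩ := h
  cases M; cases N
  simp only [PAFA.mk.injEq]
  refine ⟨?_, ?_, ?_, Fin.ext h3.1, Fin.ext h3.2.1, Fin.ext h3.2.2.1, Fin.ext h3.2.2.2⟩
  · funext c p; exact congrFun (List.ofFn_injective (congrFun hu c)) p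
  · funext c; exact describeE_inj h2 (congrFun he c)
  · funext c p a
    have := List.ofFn_injective (congrFun hU c)
    have := congrFun this p
    simp only [List.cons.injEq, List.ofFn_inj] at this
    cases a with
    | none => exact describeU_inj h2 this.1
    | some a => exact describeU_inj h2 (congrFun this.2 a)

end PAFA

/-!
The existential player sees only the common components and the public moves. Common components are
made to carry the letters only, so that everything the player can react to is what has been
recited so far: asked for a letter again and again, the player recites a word letter by letter. By
a private opening choice, the universal player decides whether the recital starts at once or only
after a first block of the input, which a finite automaton on the private components recognizes.
The player cannot tell the two cases apart and recites the same word in both. Checking the recital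
against the input in the first case makes this word the input itself; in the second case the input
is therefore compared with a copy of itself shifted by the length of the block. If the block is
the first row of a space-time diagram, local conditions on pairs of letters at this distance say
that each row is followed by its successor row, whence the accepted words are the halting
space-time diagrams of a Turing machine. The input `n` of the machine is put into the first row by
an automaton with `n + 4` states. The description of this automaton is computable from `n`, so that
deciding emptiness would decide whether the machine halts on `n`.
-/

/-! ### Strategies of the existential player -/

/-- The move to the renamed successors, with the same labels. -/
def LabelledMove.map {L α β : Type} (e : α ↪ β) : LabelledMove L α → LabelledMove L β
  | .single t => .single (e t)
  | .choice f => .choice (f.trans e)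

namespace PAFA

section Scans

variable {A : Type}

/-- The symbols scanned along a path of the computation tree, one for each transition. -/
def scans (w : List A) : List (Option A) :=
  (tape w).flatMap fun a => [a, a]

theorem getElem?_flatMap_pair {α : Type} (l : List α) (i : ℕ) :
    (l.flatMap fun a => [a, a])[i]? = l[i / 2]? := by
  induction l generalizing i with
  | nil => simp
  | cons a l ih =>
    match i with
    | 0 | 1 => simp
    | i + 2 => simp [ih, show (i + 2) / 2 = i / 2 + 1 by omega]

theorem length_scans (w : List A) : (scans w).length = depth w := by
  simp [scans, depth, mul_comm, List.length_flatMap]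

theorem drop_scans (w : List A) {i : ℕ} (hi : i < depth w) :
    (scans w).drop i = scanned w i :: (scans w).drop (i + 1) := by
  have hi' : i < (scans w).length := length_scans w ▸ hi
  rw [List.drop_eq_getElem_cons hi', scanned, List.getD_eq_getElem?_getD,
    ← getElem?_flatMap_pair, ← scans, List.getElem?_eq_getElem hi', Option.getD_some]

end Scans

section PublicMoves

variable {C P G D : Type}

theorem publicMoves_cons (e : Edge C P G D) (N : Node C P G D) :
    publicMoves (e :: N) = publicMoves N ++ (publicLabel e).toList := by
  cases h : publicLabel e <;> simp [publicMoves, h]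

end PublicMoves

variable {C P A G D : Type} [Finite C] [Finite P] [Finite A] [Finite G] [Finite D]
  {M : PAFA C P A G D} {w : List A} {T : Set (Node C P G D)}

theorem not_isUniversalNode_iff {N : Node C P G D} :
    ¬ M.IsUniversalNode N ↔ M.isUniversal (M.state N).1 (M.state N).2 = false := by
  simp [IsUniversalNode]

theorem ComputationTree.length_le {N : Node C P G D} (h : M.ComputationTree w N) :
    N.length ≤ depth w := by
  cases h with
  | root => exact Nat.zero_le _
  | child N e _ hd _ => exact hd

theorem Step.eq_inl_of_mem {s : C × P} {a : Option A} {e : Edge C P G D} (h : M.Step s a e)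
    (hs : M.isUniversal s.1 s.2 = false) {l : G ⊕ D} (hl : l ∈ e.1) : ∃ g, l = .inl g := by
  rw [Step, hs] at h
  cases hE : M.deltaE s.1 with
  | single c => simp_all
  | choice f =>
    obtain ⟨g, rfl⟩ : ∃ g, e = (some (.inl g), (f g, s.2)) := by simpa [hE] using h
    exact ⟨g, (Option.mem_some_iff.1 hl).symm⟩

theorem Step.label_eq {s s' : C × P} {a a' : Option A} {e e' : Edge C P G D} {g : G}
    (h : M.Step s a e) (h' : M.Step s' a' e') (hs : M.isUniversal s.1 s.2 = false)
    (hs' : M.isUniversal s'.1 s'.2 = false) (hss' : s.1 = s'.1) (he : ∀ l ∈ e.1, l = .inl g)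
    (he' : ∀ l ∈ e'.1, l = .inl g) : e.1 = e'.1 := by
  rw [Step, hs] at h
  rw [Step, hs', ← hss'] at h'
  cases hE : M.deltaE s.1 with
  | single c => simp_all
  | choice f =>
    simp only [hE] at h h'
    obtain ⟨⟨i, rfl⟩, ⟨j, rfl⟩⟩ := And.intro h h'
    rw [he _ rfl, he' _ rfl]

theorem Step.existsUnique {s : C × P} (hs : M.isUniversal s.1 s.2 = false) (a : Option A)
    (g : G) : ∃! e, M.Step s a e ∧ ∀ l ∈ e.1, l = .inl g := by
  simp only [Step, hs]
  cases M.deltaE s.1 with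
  | single c => exact ⟨_, ⟨rfl, by simp⟩, fun e he => he.1⟩
  | choice f =>
    refine ⟨(some (.inl g), (f g, s.2)), ⟨⟨g, rfl⟩, by simp⟩, ?_⟩
    rintro _ ⟨⟨i, rfl⟩, hi⟩
    obtain rfl : i = g := by simpa using hi
    rfl

/-- From the state `s`, with the symbols of the list still to be scanned and with the public moves
`x` seen so far, the existential player wins by answering public moves `y` at the common component
`c` with the symbol `σ c y` (which is ignored if there is a single successor). -/
def WinsFrom (M : PAFA C P A G D) (σ : C → List G → G) :
    List (Option A) → C × P → List G → Prop
  | [], s, _ => s.1 = M.accept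
  | a :: v, s, x => ∀ e, M.Step s a e →
      (M.isUniversal s.1 s.2 = false → ∀ l ∈ e.1, l = .inl (σ s.1 x)) →
        M.WinsFrom σ v e.2 (x ++ (publicLabel e).toList)

/-- The nodes of the computation tree that can be reached when the existential player uses the
strategy `σ`. -/
inductive Follows (M : PAFA C P A G D) (σ : C → List G → G) (w : List A) :
    Node C P G D → Prop
  | root : Follows M σ w []
  | child (N : Node C P G D) (e : Edge C P G D) :
      Follows M σ w N → N.length < depth w → M.Step (M.state N) (scanned w N.length) e →
      (¬ M.IsUniversalNode N → ∀ l ∈ e.1, l = .inl (σ (M.state N).1 (publicMoves N))) →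
      Follows M σ w (e :: N)

theorem Follows.computationTree {σ : C → List G → G} {N : Node C P G D}
    (h : M.Follows σ w N) : M.ComputationTree w N := by
  induction h with
  | root => exact .root
  | child N e _ hd hs _ ih => exact .child N e ih hd hs

theorem Follows.winsFrom {σ : C → List G → G} {N : Node C P G D} (h : M.Follows σ w N)
    (hσ : M.WinsFrom σ (scans w) (M.initC, M.initP) []) :
    M.WinsFrom σ ((scans w).drop N.length) (M.state N) (publicMoves N) := by
  induction h with
  | root => exact hσ
  | child N e _ hd hs hl ih =>
    rw [drop_scans w hd] at ih
    rw [publicMoves_cons]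
    exact ih e hs fun h => hl (not_isUniversalNode_iff.2 h)

theorem isAcceptingSubtree_follows {σ : C → List G → G}
    (hσ : M.WinsFrom σ (scans w) (M.initC, M.initP) []) :
    M.IsAcceptingSubtree w {N | M.Follows σ w N} where
  subset _ hN := hN.computationTree
  root_mem := .root
  parent_mem := by rintro N e ⟨⟩; assumption
  existential N hN hd hu := by
    obtain ⟨e, ⟨hs, hl⟩, huniq⟩ := Step.existsUnique (not_isUniversalNode_iff.1 hu)
      (scanned w N.length) (σ (M.state N).1 (publicMoves N))
    refine ⟨e, .child N e hN hd hs fun _ => hl, ?_⟩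
    rintro e' ⟨⟩
    exact huniq e' ⟨by assumption, by tauto⟩
  universal := by
    rintro N hN hu e ⟨⟩
    exact .child N e hN (by assumption) (by assumption) (absurd hu)
  leaf N hN hd := by
    have h := hN.winsFrom hσ
    rwa [hd, ← length_scans, List.drop_length] at h
  privacy := by
    rintro N₁ N₂ e₁ e₂ (_ | ⟨_, _, _, _, hs₁, hl₁⟩) (_ | ⟨_, _, _, _, hs₂, hl₂⟩) hu₁ hu₂ hc hx
    exact hs₁.label_eq hs₂ (not_isUniversalNode_iff.1 hu₁) (not_isUniversalNode_iff.1 hu₂) hc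
      (hl₁ hu₁) (hc ▸ hx ▸ hl₂ hu₂)

namespace IsAcceptingSubtree

theorem step (hT : M.IsAcceptingSubtree w T) {N : Node C P G D} {e : Edge C P G D}
    (he : e :: N ∈ T) : M.Step (M.state N) (scanned w N.length) e := by
  obtain _ | ⟨_, _, _, _, hs⟩ := hT.subset _ he
  exact hs

theorem exists_strategy (hT : M.IsAcceptingSubtree w T) : ∃ σ : C → List G → G,
    ∀ N e, e :: N ∈ T → ¬ M.IsUniversalNode N →
      ∀ l ∈ e.1, l = .inl (σ (M.state N).1 (publicMoves N)) := by
  suffices h : ∀ c x, ∃ g, ∀ N e, e :: N ∈ T → ¬ M.IsUniversalNode N → (M.state N).1 = c →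
      publicMoves N = x → ∀ l ∈ e.1, l = (.inl g : G ⊕ D) by
    choose σ hσ using h
    exact ⟨σ, fun N e he hu => hσ _ _ N e he hu rfl rfl⟩
  intro c x
  by_cases h : ∃ N e, e :: N ∈ T ∧ ¬ M.IsUniversalNode N ∧ (M.state N).1 = c ∧
      publicMoves N = x ∧ e.1.isSome
  · obtain ⟨N, e, he, hu, rfl, rfl, hl⟩ := h
    obtain ⟨l, hl⟩ := Option.isSome_iff_exists.1 hl
    obtain ⟨g, rfl⟩ := (hT.step he).eq_inl_of_mem (not_isUniversalNode_iff.1 hu) hl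
    refine ⟨g, fun N' e' he' hu' hc hx l' hl' => ?_⟩
    rw [hT.privacy N' N e' e he' he hu' hu hc hx, hl] at hl'
    exact (Option.mem_some_iff.1 hl').symm
  · have := M.public_nontrivial
    refine ⟨Classical.arbitrary G, fun N e he hu hc hx l hl => absurd ?_ h⟩
    exact ⟨N, e, he, hu, hc, hx, Option.isSome_iff_exists.2 ⟨l, hl⟩⟩

theorem winsFrom (hT : M.IsAcceptingSubtree w T) {σ : C → List G → G}
    (hσ : ∀ N e, e :: N ∈ T → ¬ M.IsUniversalNode N →
      ∀ l ∈ e.1, l = .inl (σ (M.state N).1 (publicMoves N)))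
    {N : Node C P G D} (hN : N ∈ T) :
    M.WinsFrom σ ((scans w).drop N.length) (M.state N) (publicMoves N) := by
  induction hv : (scans w).drop N.length generalizing N with
  | nil =>
    exact hT.leaf N hN <| (hT.subset N hN).length_le.antisymm <|
      length_scans w ▸ List.drop_eq_nil_iff.1 hv
  | cons a v ih => 
    have hd : N.length < depth w := by
      rw [← length_scans]
      by_contra! h
      simp [List.drop_eq_nil_of_le h] at hv
    obtain ⟨rfl, rfl⟩ := List.cons.inj ((drop_scans w hd).symm.trans hv)
    intro e hs hl
    rw [← publicMoves_cons]
    refine ih (N := e :: N) ?_ rfl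
    by_cases hu : M.IsUniversalNode N
    · exact hT.universal N hN hu e (.child N e (hT.subset N hN) hd hs)
    · obtain ⟨e', he', -⟩ := hT.existential N hN hd hu
      have hu' := not_isUniversalNode_iff.1 hu
      rwa [(Step.existsUnique hu' _ _).unique ⟨hs, hl hu'⟩ ⟨hT.step he', hσ N e' he' hu⟩]

end IsAcceptingSubtree

theorem mem_language_iff : w ∈ M.language ↔
    ∃ σ, M.WinsFrom σ (scans w) (M.initC, M.initP) [] := by
  constructor
  · rintro ⟨T, hT⟩
    obtain ⟨σ, hσ⟩ := hT.exists_strategy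
    exact ⟨σ, hT.winsFrom hσ hT.root_mem⟩
  · rintro ⟨σ, hσ⟩
    exact ⟨_, isAcceptingSubtree_follows hσ⟩

section Reindex

variable {C' P' : Type} [Finite C'] [Finite P']

/-- The automaton with the state components renamed. -/
def reindex (M : PAFA C P A G D) (eC : C ≃ C') (eP : P ≃ P') : PAFA C' P' A G D where
  isUniversal c p := M.isUniversal (eC.symm c) (eP.symm p)
  deltaE c := (M.deltaE (eC.symm c)).map eC.toEmbedding
  deltaU c p a := (M.deltaU (eC.symm c) (eP.symm p) a).map (eC.prodCongr eP).toEmbedding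
  initC := eC M.initC
  initP := eP M.initP
  accept := eC M.accept
  reject := eC M.reject
  public_nontrivial := M.public_nontrivial
  private_nontrivial := M.private_nontrivial
  public_move c p a f hf g := by
    cases h : M.deltaU (eC.symm c) (eP.symm p) a with
    | single t => simp [h, LabelledMove.map] at hf
    | choice f' =>
      obtain rfl : f'.trans (eC.prodCongr eP).toEmbedding = f := by
        simpa [h, LabelledMove.map] using hf
      simp [M.public_move _ _ _ _ h g]

variable (eC : C ≃ C') (eP : P ≃ P')

theorem step_reindex (s t : C' × P') (a : Option A) (l : Option (G ⊕ D)) :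
    (M.reindex eC eP).Step s a (l, t) ↔
      M.Step (eC.symm s.1, eP.symm s.2) a (l, (eC.symm t.1, eP.symm t.2)) := by
  simp only [Step, reindex]
  split
  · cases M.deltaU (eC.symm s.1) (eP.symm s.2) a <;>
      simp [LabelledMove.map, Prod.ext_iff, Equiv.symm_apply_eq]
  · cases M.deltaE (eC.symm s.1) <;>
      simp [LabelledMove.map, Prod.ext_iff, Equiv.symm_apply_eq]

theorem winsFrom_reindex (σ : C' → List G → G) (v : List (Option A)) (s : C' × P') (x : List G) :
    (M.reindex eC eP).WinsFrom σ v s x ↔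
      M.WinsFrom (σ ∘ eC) v (eC.symm s.1, eP.symm s.2) x := by
  induction v generalizing s x with
  | nil => simp [WinsFrom, reindex, Equiv.symm_apply_eq]
  | cons a v ih =>
    simp only [WinsFrom, ih]
    constructor
    · rintro h ⟨l, t⟩ hs hl
      simpa [publicLabel] using h (l, (eC t.1, eP t.2)) (by simpa [step_reindex] using hs)
        (by simpa [reindex] using hl)
    · rintro h ⟨l, t⟩ hs hl
      exact h (l, (eC.symm t.1, eP.symm t.2)) ((step_reindex ..).1 hs)
        (by simpa [reindex] using hl)

theorem language_reindex : (M.reindex eC eP).language = M.language := by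
  ext w
  simp only [mem_language_iff, winsFrom_reindex]
  rw [← (eC.arrowCongr (Equiv.refl (List G → G))).exists_congr_right]
  simp [reindex, Function.comp_def]

end Reindex

end PAFA

/-! ### Delay tests -/

/-- A deterministic automaton that reads a block at the front of a word: the block ends with the
first letter at which `step` takes the value `none`. -/
structure BlockAutomaton (B W : Type) where
  start : W
  step : W → B → Option W

/-- The word is a block, when it is read from the state `q`. -/
def BlockAutomaton.Reads {B W : Type} (R : BlockAutomaton B W) : W → List B → Prop
  | _, [] => False
  | q, a :: u =>
    match R.step q a with
    | none => u = []
    | some q' => R.Reads q' u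

theorem BlockAutomaton.exists_append_eq_cons {B W : Type} (R : BlockAutomaton B W) (q : W) (a : B)
    (w : List B) (p : List B → Prop) :
    (∃ u v, a :: w = u ++ v ∧ R.Reads q u ∧ p v) ↔
      match R.step q a with
      | none => p w
      | some q' => ∃ u v, w = u ++ v ∧ R.Reads q' u ∧ p v := by
  constructor
  · rintro ⟨_ | ⟨_, u⟩, v, h, hu, hv⟩
    · exact hu.elim
    · obtain ⟨rfl, rfl⟩ := List.cons.inj h
      rw [Reads] at hu
      split at hu
      · simpa [hu, ‹R.step _ _ = _›] using hv
      · simpa only [‹R.step _ _ = _›] using ⟨u, v, rfl, hu, hv⟩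
  · intro h
    split at h
    · exact ⟨[a], w, rfl, by simp [Reads, ‹R.step _ _ = _›], h⟩
    · obtain ⟨u, v, rfl, hu, hv⟩ := h
      exact ⟨a :: u, v, rfl, by simpa only [Reads, ‹R.step _ _ = _›], hv⟩

/-- Conditions on a word: `adj` on the pairs of consecutive letters, `rel` on the pairs of letters
at a certain distance, the delay, and `final` on the last letter. -/
structure DelayTest (B : Type) where
  adj : B → B → Prop
  rel : B → B → Prop
  final : B → Prop

namespace DelayTest

variable {B W : Type}

/-- The word passes the test, the delay being the length of a block at the front of the word. -/
def Passes (S : DelayTest B) (R : BlockAutomaton B W) (w : List B) : Prop :=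
  (w.IsChain S.adj ∧ ∃ a ∈ w.getLast?, S.final a) ∧
    ∃ u v, w = u ++ v ∧ R.Reads R.start u ∧ ∀ p ∈ w.zip v, S.rel p.1 p.2

/-- The tasks of the private player: to check that the existential player recites the input, the
last letter of which was `prev`, or to compare the recital with a later part of the input. -/
inductive Task (B : Type) : Type
  | idle
  | dead
  | chain (prev : Option B)
  | compare

/-- The private state components of the automaton for a test: a task, or a state of the block
automaton as long as this one is reading. The common components are `none` and the letters; in
`none` the existential player chooses the next letter of the recital. -/
abbrev Mode (B W : Type) : Type := Task B ⊕ W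

/-- The existential states are `(none, m)` for these modes `m`. -/
def Mode.isReciting : Mode B W → Bool
  | .inl (.chain _) | .inl .compare => true
  | _ => false

variable (S : DelayTest B) (R : BlockAutomaton B W) (g₀ : B)

open Classical in
/-- The transitions from the universal states other than the initial one. The state
`(some g₀, .inl .idle)` is the accepting one, and `(none, .inl .dead)` cannot be left. -/
noncomputable def next : Option B → Mode B W → Option B → Option B × Mode B W
  | some _, .inl .idle, _ => (some g₀, .inl .idle)
  | some g, .inl (.chain prev), some a =>
    if a = g ∧ ∀ b ∈ prev, S.adj b a then (none, .inl (.chain (some a))) else (none, .inl .dead)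
  | some _, .inl (.chain prev), none =>
    if ∃ a ∈ prev, S.final a then (some g₀, .inl .idle) else (none, .inl .dead)
  | some g, .inl .compare, some a =>
    if S.rel g a then (none, .inl .compare) else (none, .inl .dead)
  | some _, .inl .compare, none => (some g₀, .inl .idle)
  | none, .inr q, _ => (some g₀, .inr q)
  | some _, .inr q, some a =>
    match R.step q a with
    | none => (none, .inl .compare)
    | some q' => (none, .inr q')
  | _, _, _ => (none, .inl .dead)

/-- The first move, made by the universal player: a private move starts the recital at once, or
only behind the first block. The public moves, which have to exist as well, are a win for the
existential player. -/
def opening : B ⊕ Fin 2 ↪ Option B × Mode B W where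
  toFun
    | .inl g => (some g, .inl .idle)
    | .inr 0 => (none, .inl (.chain none))
    | .inr 1 => (none, .inr R.start)
  inj' := by
    rintro (g | d) (g' | d') h
    · simpa using h
    · fin_cases d' <;> simp at h
    · fin_cases d <;> simp at h
    · fin_cases d <;> fin_cases d' <;> simp at h ⊢

/-- The universal transition function. -/
noncomputable def move :
    Option B → Mode B W → Option B → LabelledMove (B ⊕ Fin 2) (Option B × Mode B W)
  | none, .inl .idle, _ => .choice (opening R)
  | c, m, a => .single (S.next R g₀ c m a)

section Automaton

variable [Finite B] [Finite W] [Nontrivial B]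

instance : Finite (Task B) :=
  Finite.of_surjective (Sum.elim ![.idle, .dead, .compare] .chain) <| by
    rintro (_ | _ | p | _)
    exacts [⟨.inl 0, rfl⟩, ⟨.inl 1, rfl⟩, ⟨.inr p, rfl⟩, ⟨.inl 2, rfl⟩]

/-- The automaton for a test. -/
noncomputable def automaton : PAFA (Option B) (Mode B W) B B (Fin 2) where
  isUniversal c m := c.isSome || !m.isReciting
  deltaE
    | none => .choice .some
    | some g => .single (some g)
  deltaU := S.move R g₀
  initC := none
  initP := .inl .idle
  accept := some g₀
  reject := none
  public_nontrivial := inferInstance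
  private_nontrivial := inferInstance
  public_move c m a f hf g := by
    rcases c with _ | c <;> rcases m with (_ | _ | _ | _) | _ <;>
      simp only [move, reduceCtorEq, LabelledMove.choice.injEq] at hf
    subst hf
    rfl

variable {S R g₀} {σ : Option B → List B → B}

theorem winsFrom_cons_recite {m : Mode B W} (hm : m.isReciting) (a : Option B)
    (v : List (Option B)) (x : List B) :
    (S.automaton R g₀).WinsFrom σ (a :: v) (none, m) x ↔
      (S.automaton R g₀).WinsFrom σ v (some (σ none x), m) (x ++ [σ none x]) := by
  simp [PAFA.WinsFrom, PAFA.Step, automaton, hm, PAFA.publicLabel]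

theorem winsFrom_cons_opening (a : Option B) (v : List (Option B)) (x : List B) :
    (S.automaton R g₀).WinsFrom σ (a :: v) (none, .inl .idle) x ↔
      (∀ g, (S.automaton R g₀).WinsFrom σ v (some g, .inl .idle) (x ++ [g])) ∧
      (S.automaton R g₀).WinsFrom σ v (none, .inl (.chain none)) x ∧
        (S.automaton R g₀).WinsFrom σ v (none, .inr R.start) x := by
  have h : (S.automaton R g₀).WinsFrom σ (a :: v) (none, .inl .idle) x ↔
      ∀ l, (S.automaton R g₀).WinsFrom σ v (opening R l) (x ++ l.getLeft?.toList) :=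
    ⟨fun h l => h (some l, opening R l) ⟨l, rfl⟩ nofun, by rintro h _ ⟨l, rfl⟩ _; exact h l⟩
  simp only [h, Sum.forall, Fin.forall_fin_two, Sum.getLeft?_inl, Sum.getLeft?_inr,
    Option.toList_some, Option.toList_none, List.append_nil]
  rfl

theorem winsFrom_cons_next {c : Option B} {m : Mode B W} (hm : c.isSome ∨ m.isReciting = false)
    (h : (c, m) ≠ (none, .inl .idle)) (a : Option B) (v : List (Option B)) (x : List B) :
    (S.automaton R g₀).WinsFrom σ (a :: v) (c, m) x ↔
      (S.automaton R g₀).WinsFrom σ v (S.next R g₀ c m a) x := by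
  have hmove : S.move R g₀ c m a = .single (S.next R g₀ c m a) := by
    rcases c with _ | c <;> rcases m with (_ | _ | _ | _) | _ <;> simp_all [move]
  have hu : (c.isSome || !m.isReciting) = true := by simpa using hm
  simp [PAFA.WinsFrom, PAFA.Step, automaton, hmove, hu, PAFA.publicLabel]

theorem winsFrom_cons_some (c : B) (m : Mode B W) (a : Option B) (v : List (Option B))
    (x : List B) :
    (S.automaton R g₀).WinsFrom σ (a :: v) (some c, m) x ↔
      (S.automaton R g₀).WinsFrom σ v (S.next R g₀ (some c) m a) x :=
  winsFrom_cons_next (.inl rfl) (by simp) a v x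

theorem winsFrom_won (v : List (Option B)) (x : List B) :
    (S.automaton R g₀).WinsFrom σ v (some g₀, .inl .idle) x := by
  induction v with
  | nil => rfl
  | cons a v ih => rwa [winsFrom_cons_some]

theorem not_winsFrom_dead (v : List (Option B)) (x : List B) :
    ¬ (S.automaton R g₀).WinsFrom σ v (none, .inl .dead) x := by
  induction v with
  | nil => simp [PAFA.WinsFrom, automaton]
  | cons a v ih => rwa [winsFrom_cons_next (.inr rfl) (by simp)]

/-- What is scanned until the end of the input `v`, after a first transition on the symbol `b`. A
move of the existential player and the answer to it scan adjacent tape symbols. -/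
def rounds : Option B → List B → List (Option B)
  | b, [] => [b, none, none]
  | b, a :: v => b :: some a :: rounds (some a) v

omit [Finite B] [Nontrivial B] in
theorem scans_eq_rounds (w : List B) : PAFA.scans w = none :: rounds none w := by
  have h (b : Option B) : b :: (w.map some ++ [none]).flatMap (fun a => [a, a]) = rounds b w := by
    induction w generalizing b with
    | nil => rfl
    | cons a w ih => simp [rounds, ← ih]
  rw [← h]
  rfl

/-- The strategy `τ`, which depends only on the letters recited so far, continues the recital `x`
by `y`. -/
def Recites (τ : List B → B) : List B → List B → Prop
  | _, [] => True
  | x, a :: y => τ x = a ∧ Recites τ (x ++ [a]) y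

omit [Finite B] in
theorem exists_recites (w : List B) : ∃ τ, Recites τ [] w := by
  refine ⟨fun x => (w.drop x.length).headD (Classical.arbitrary B), ?_⟩
  suffices h : ∀ x y, w = x ++ y →
      Recites (fun x => (w.drop x.length).headD (Classical.arbitrary B)) x y from h [] w rfl
  intro x y hy
  induction y generalizing x with
  | nil => trivial
  | cons a y ih => exact ⟨by simp [hy], ih _ (by simp [hy])⟩

theorem winsFrom_chain (p b : Option B) (v x : List B) :
    (S.automaton R g₀).WinsFrom σ (rounds b v) (none, .inl (.chain p)) x ↔
      Recites (σ none) x v ∧ (p.toList ++ v).IsChain S.adj ∧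
        ∃ a ∈ (p.toList ++ v).getLast?, S.final a := by
  induction v generalizing p b x with
  | nil =>
    rw [rounds, winsFrom_cons_recite rfl, winsFrom_cons_some, next]
    split_ifs with hp
    · cases p <;> simp_all [winsFrom_won, Recites]
    · cases p <;> simp_all [not_winsFrom_dead]
  | cons a v ih =>
    rw [rounds, winsFrom_cons_recite rfl, winsFrom_cons_some, next]
    split_ifs with ha
    · obtain ⟨rfl, hp⟩ := ha
      rw [ih]
      cases p <;> simp_all [Recites, List.getLast?_cons_cons]
    · refine iff_of_false (not_winsFrom_dead _ _) fun h => ha ⟨h.1.1.symm, fun b hb => ?_⟩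
      obtain rfl := hb
      exact (List.isChain_cons_cons.1 h.2.1).1

theorem winsFrom_compare {x y : List B} (hy : Recites (σ none) x y) {v : List B}
    (hv : v.length ≤ y.length) (b : Option B) :
    (S.automaton R g₀).WinsFrom σ (rounds b v) (none, .inl .compare) x ↔
      ∀ p ∈ y.zip v, S.rel p.1 p.2 := by
  induction v generalizing x y b with
  | nil =>
    rw [rounds, winsFrom_cons_recite rfl, winsFrom_cons_some]
    simp [next, winsFrom_won]
  | cons a v ih =>
    obtain _ | ⟨_, y⟩ := y
    · simp at hv
    obtain ⟨rfl, hy⟩ := hy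
    rw [rounds, winsFrom_cons_recite rfl, winsFrom_cons_some, next, List.zip_cons_cons,
      List.forall_mem_cons]
    split_ifs with ha
    · simp [ih hy (by simpa using hv), ha]
    · simp [not_winsFrom_dead, ha]

theorem winsFrom_reading {y : List B} (hy : Recites (σ none) [] y) {v : List B}
    (hv : v.length ≤ y.length) (q : W) (b : Option B) :
    (S.automaton R g₀).WinsFrom σ (rounds b v) (none, .inr q) [] ↔
      ∃ u v', v = u ++ v' ∧ R.Reads q u ∧ ∀ p ∈ y.zip v', S.rel p.1 p.2 := by
  induction v generalizing q b with
  | nil =>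
    simp [rounds, winsFrom_cons_next, Mode.isReciting, next, not_winsFrom_dead,
      BlockAutomaton.Reads]
  | cons a v ih =>
    have hv' : v.length ≤ y.length := (Nat.le_succ _).trans hv
    rw [rounds, winsFrom_cons_next (.inr rfl) (by simp), next, winsFrom_cons_some, next,
      R.exists_append_eq_cons]
    split
    · exact winsFrom_compare hy hv' _
    · exact ih hv' _ _

theorem mem_language_iff {w : List B} : w ∈ (S.automaton R g₀).language ↔ S.Passes R w := by
  rw [PAFA.mem_language_iff]
  have h (σ : Option B → List B → B) :
      (S.automaton R g₀).WinsFrom σ (PAFA.scans w) (none, .inl .idle) [] ↔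
        Recites (σ none) [] w ∧ S.Passes R w := by
    have hpublic (g : B) :
        (S.automaton R g₀).WinsFrom σ (rounds none w) (some g, .inl .idle) ([] ++ [g]) := by
      cases w <;> rw [rounds, winsFrom_cons_some] <;> exact winsFrom_won _ _
    rw [scans_eq_rounds, winsFrom_cons_opening, winsFrom_chain, Passes,
      and_iff_right hpublic, and_assoc]
    exact and_congr_right fun hw => and_congr_right fun _ => winsFrom_reading hw le_rfl _ _
  refine (exists_congr h).trans ⟨fun ⟨_, _, h⟩ => h, fun h => ?_⟩
  obtain ⟨τ, hτ⟩ := exists_recites w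
  exact ⟨fun _ => τ, hτ, h⟩

end Automaton

end DelayTest

/-! ### A machine with an undecidable halting problem -/

section UndecidableMachine

theorem exists_partrec_comp_eq {α σ : Type*} [Primcodable α] [Primcodable σ] {h : ℕ → α}
    (hh : Computable h) (hinj : Function.Injective h) {f : ℕ →. σ} (hf : Partrec f) :
    ∃ g : α →. σ, Partrec g ∧ ∀ n, g (h n) = f n := by
  classical
  let inv (x : α) : Part ℕ := Nat.rfind fun n => (decide (h n = x) : Bool)
  have hinv : Partrec inv :=
    Partrec.rfind ((Primrec.eq (α := α)).decide.to_comp.comp (hh.comp .snd) .fst).to₂.partrec₂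
  refine ⟨fun x => (inv x).bind f, hinv.bind (hf.comp .snd), fun n => ?_⟩
  have : inv (h n) = Part.some n := Part.eq_some_iff.2 <| Nat.mem_rfind.2
    ⟨by simp, fun {m} hm => by simpa using fun h' => hm.ne (hinj h')⟩
  exact (congrArg (Part.bind · f) this).trans (Part.bind_some _ _)

theorem exists_partrec_not_computablePred_dom {h : ℕ → ℕ} (hh : Computable h)
    (hinj : Function.Injective h) :
    ∃ g : ℕ →. ℕ, Partrec g ∧ ¬ ComputablePred fun n => (g (h n)).Dom := by
  obtain ⟨g, hg, hgh⟩ := exists_partrec_comp_eq hh hinj <|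
    Nat.Partrec.Code.eval_part.comp (Computable.ofNat Nat.Partrec.Code) (Computable.const 0)
  refine ⟨g, hg, fun hdom => ComputablePred.halting_problem 0 ?_⟩
  exact ComputablePred.computable_of_manyOneReducible
    ⟨Encodable.encode, .encode, fun c => by simp [hgh]⟩ hdom

open Turing StateTransition

theorem exists_finite_machine_of_supports {Γ Λ : Type} [Inhabited Γ] [Inhabited Λ]
    {M : TM0.Machine Γ Λ} {S : Set Λ} (hfin : S.Finite) (hS : TM0.Supports M S) :
    ∃ (Λ' : Type) (_ : Inhabited Λ') (_ : Finite Λ') (M' : TM0.Machine Γ Λ'), ∀ l,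
      (eval (TM0.step M') (TM0.init l)).Dom ↔ (eval (TM0.step M) (TM0.init l)).Dom := by
  classical
  let : Inhabited S := ⟨default, hS.1⟩
  let g₁ : PointedMap Λ S :=
    ⟨fun q => if h : q ∈ S then ⟨q, h⟩ else default, by simp [hS.1]; rfl⟩
  refine ⟨S, inferInstance, hfin, M.map ⟨id, rfl⟩ ⟨id, rfl⟩ g₁ Subtype.val, fun l => ?_⟩
  have h := TM0.Machine.map_respects M ⟨id, rfl⟩ ⟨id, rfl⟩ g₁ Subtype.val hS (fun _ => rfl)
    fun q hq => by simp [g₁, hq]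
  refine tr_eval_dom h ⟨hS.1, ?_⟩
  rw [TM0.map_init]
  simp

instance : Finite PartrecToTM2.K' :=
  Finite.of_surjective ![.main, .rev, .aux, .stack] <| by
    rintro (_ | _ | _ | _)
    exacts [⟨0, rfl⟩, ⟨1, rfl⟩, ⟨2, rfl⟩, ⟨3, rfl⟩]

theorem trNat_two_pow_sub_one (m : ℕ) :
    PartrecToTM2.trNat (2 ^ m - 1) = List.replicate m .bit1 := by
  induction m with
  | zero => simp
  | succ m ih =>
    have h : 2 ^ (m + 1) - 1 = Nat.bit true (2 ^ m - 1) := by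
      have := Nat.one_le_two_pow (n := m)
      simp only [Nat.bit_val, pow_succ, Bool.toNat_true]
      omega
    rw [h, List.replicate_succ, ← ih]
    simp only [PartrecToTM2.trNat]
    rw [← Num.ofNat'_eq, ← Num.ofNat'_eq, Num.ofNat'_bit]
    cases Num.ofNat' (2 ^ m - 1) <;> rfl

/-- The alphabet of the one-tape machine that simulates the stack machine of a code. -/
abbrev TapeAlphabet : Type := TM2to1.Γ' PartrecToTM2.K' fun _ => PartrecToTM2.Γ'

instance : Finite TapeAlphabet :=
  inferInstanceAs (Finite (Bool × _))

/-- The symbol for a cell in which only the main stack is occupied. The flag marks the bottom of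
the stacks. -/
def mainSymbol (bottom : Bool) (a : PartrecToTM2.Γ') : TapeAlphabet :=
  (bottom, Function.update (fun _ => none) .main (some a))

theorem trInit_trList_two_pow_sub_one (m : ℕ) :
    TM2to1.trInit (Γ := fun _ => PartrecToTM2.Γ') PartrecToTM2.K'.main
        (PartrecToTM2.trList [2 ^ m - 1]) =
      mainSymbol true .cons :: List.replicate m (mainSymbol false .bit1) := by
  rw [TM2to1.trInit, show (PartrecToTM2.trList [2 ^ m - 1]).reverse =
    .cons :: List.replicate m .bit1 by simp [PartrecToTM2.trList, trNat_two_pow_sub_one]]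
  change _ :: (List.replicate m _).map (mainSymbol false) = _
  rw [List.map_replicate]
  rfl

theorem eval_dom_iff_of_code (c : ToPartrec.Code) (v : List ℕ) :
    letI : Inhabited PartrecToTM2.Λ' := ⟨PartrecToTM2.trNormal c .halt⟩
    (eval (TM0.step (TM1to0.tr (TM2to1.tr PartrecToTM2.tr)))
      (TM0.init (TM2to1.trInit (Γ := fun _ => PartrecToTM2.Γ') PartrecToTM2.K'.main
        (PartrecToTM2.trList v)))).Dom ↔ (c.eval v).Dom := by
  let : Inhabited PartrecToTM2.Λ' := ⟨PartrecToTM2.trNormal c .halt⟩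
  have hinit : TM2.init (Λ := PartrecToTM2.Λ') PartrecToTM2.K'.main (PartrecToTM2.trList v) =
      PartrecToTM2.init c v := by
    unfold TM2.init PartrecToTM2.init
    congr 1
    funext k
    cases k <;> rfl
  have h₂₁ := tr_eval_dom (TM2to1.tr_respects PartrecToTM2.tr)
    (TM2to1.trCfg_init .main (PartrecToTM2.trList v))
  rw [hinit, PartrecToTM2.tr_eval] at h₂₁
  exact (tr_eval_dom (TM1to0.tr_respects _) (a₁ := TM1.init _) (a₂ := TM0.init _) rfl).trans h₂₁

theorem exists_finite_machine_of_code (c : ToPartrec.Code) :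
    ∃ (Λ : Type) (_ : Inhabited Λ) (_ : Finite Λ) (M : TM0.Machine TapeAlphabet Λ), ∀ m : ℕ,
      (eval (TM0.step M) (TM0.init
        (mainSymbol true .cons :: List.replicate m (mainSymbol false .bit1)))).Dom ↔
          (c.eval [2 ^ m - 1]).Dom := by
  let : Inhabited PartrecToTM2.Λ' := ⟨PartrecToTM2.trNormal c .halt⟩
  have hS := TM1to0.tr_supports _ <| TM2to1.tr_supports _ (PartrecToTM2.tr_supports c .halt)
  obtain ⟨Λ, _, _, M, hM⟩ := exists_finite_machine_of_supports (Finset.finite_toSet _) hS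
  refine ⟨Λ, _, ‹_›, M, fun m => ?_⟩
  rw [hM, ← trInit_trList_two_pow_sub_one, eval_dom_iff_of_code]

theorem exists_finite_machine_not_computablePred_dom :
    ∃ (Γ Λ : Type) (_ : Inhabited Γ) (_ : Inhabited Λ) (_ : Finite Γ) (_ : Finite Λ)
      (M : TM0.Machine Γ Λ) (X Y : Γ), ¬ ComputablePred fun n : ℕ =>
        (eval (TM0.step M) (TM0.init (X :: List.replicate n Y))).Dom := by
  -- In binary, `2 ^ n - 1` consists of `n` ones, which makes the input of the machine unary.
  have hcomp : Computable fun n : ℕ => 2 ^ n - 1 := (Primrec.nat_sub.comp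
    ((Primrec₂.unpaired'.1 Nat.Primrec.pow).comp (.const 2) .id) (.const 1)).to_comp
  have hinj : Function.Injective fun n : ℕ => 2 ^ n - 1 := fun m n h =>
    Nat.pow_right_injective le_rfl <| Nat.pred_inj m.two_pow_pos n.two_pow_pos h
  obtain ⟨g, hg, hdom⟩ := exists_partrec_not_computablePred_dom hcomp hinj
  obtain ⟨c, hc⟩ := ToPartrec.Code.exists_code (Nat.Partrec'.part_iff₁.2 hg)
  obtain ⟨Λ, _, _, M, hM⟩ := exists_finite_machine_of_code c
  have hdom_iff (n : ℕ) : (c.eval [2 ^ n - 1]).Dom ↔ (g (2 ^ n - 1)).Dom := by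
    rw [show c.eval [2 ^ n - 1] = _ from hc ⟨[2 ^ n - 1], rfl⟩]
    rfl
  exact ⟨TapeAlphabet, Λ, inferInstance, _, inferInstance, ‹_›, M, _, _,
    fun h => hdom (h.of_eq fun n => (hM n).trans (hdom_iff n))⟩

end UndecidableMachine

/-! ### Space-time diagrams -/

theorem reaches_iterate_getD {σ : Type*} (f : σ → Option σ) (a : σ) (r : ℕ) :
    StateTransition.Reaches f a ((fun a => (f a).getD a)^[r] a) := by
  induction r with
  | zero => exact .refl
  | succ r ih =>
    rw [Function.iterate_succ_apply']
    cases h : f ((fun a => (f a).getD a)^[r] a) with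
    | none => exact ih
    | some c => exact ih.tail h

theorem exists_iterate_getD_eq {σ : Type*} {f : σ → Option σ} {a b : σ}
    (h : StateTransition.Reaches f a b) : ∃ r, (fun a => (f a).getD a)^[r] a = b := by
  induction h with
  | refl => exact ⟨0, rfl⟩
  | tail _ h ih =>
    obtain ⟨r, rfl⟩ := ih
    refine ⟨r + 1, ?_⟩
    rw [Function.iterate_succ_apply', Option.mem_def.1 h, Option.getD_some]

theorem eval_dom_iff_exists_iterate {σ : Type*} {f : σ → Option σ} {a : σ} :
    (StateTransition.eval f a).Dom ↔ ∃ r, f ((fun a => (f a).getD a)^[r] a) = none := by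
  rw [Part.dom_iff_mem]
  constructor
  · rintro ⟨c, hc⟩
    obtain ⟨hreach, hhalt⟩ := StateTransition.mem_eval.1 hc
    obtain ⟨r, rfl⟩ := exists_iterate_getD_eq hreach
    exact ⟨r, hhalt⟩
  · rintro ⟨r, hr⟩
    exact ⟨_, StateTransition.mem_eval.2 ⟨reaches_iterate_getD f a r, hr⟩⟩

section SpaceTime

open Turing

variable {Γ Λ : Type}

/-- A configuration of a Turing machine with the position of its head on the integer line. -/
structure PosCfg (Γ Λ : Type) [Inhabited Γ] where
  cfg : TM0.Cfg Γ Λ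
  pos : ℤ

/-- A cell of a row of a space-time diagram: `none` is a separator, otherwise there is a symbol
and, where the head is, the state. -/
abbrev Cell (Γ Λ : Type) : Type := Option (Γ × Option Λ)

variable [Inhabited Λ]

namespace Cell

/-- The cell shows that the machine has halted. -/
def Halted (M : TM0.Machine Γ Λ) (c : Cell Γ Λ) : Prop :=
  ∃ a q, c = some (a, some q) ∧ M q a = none

/-- The head is not at the cell. -/
def Headless (c : Cell Γ Λ) : Prop :=
  ∀ x ∈ c, x.2 = none

/-- The state in which the head leaves the cell in the direction `d`, if it does. -/
def leaves (M : TM0.Machine Γ Λ) (d : Dir) : Cell Γ Λ → Option Λ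
  | some (a, some q) =>
    match M q a, d with
    | some (q', .move .left), .left => some q'
    | some (q', .move .right), .right => some q'
    | _, _ => none
  | _ => none

/-- The cell one time step later, given its neighbours `l` and `r`. -/
def next (M : TM0.Machine Γ Λ) (l c r : Cell Γ Λ) : Cell Γ Λ :=
  match c with
  | none => none
  | some (a, some q) =>
    match M q a with
    | none => some (a, some q)
    | some (_, .move _) => some (a, none)
    | some (q', .write b) => some (b, some q')
  | some (a, none) => some (a, (leaves M .right l).or (leaves M .left r))

variable {M : TM0.Machine Γ Λ} {l l' c r r' : Cell Γ Λ}

theorem Headless.leaves_eq_none (h : c.Headless) (d : Dir) : leaves M d c = none := by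
  obtain _ | ⟨a, q⟩ := c
  · rfl
  · obtain rfl : q = none := h _ rfl
    rfl

theorem Headless.next (hl : l.Headless) (hc : c.Headless) (hr : r.Headless) :
    (next M l c r).Headless := by
  obtain _ | ⟨a, q⟩ := c
  · exact hc
  · obtain rfl : q = none := hc _ rfl
    simp [Cell.next, Headless, hl.leaves_eq_none, hr.leaves_eq_none]

theorem Halted.not_headless (h : c.Halted M) : ¬ c.Headless := by
  obtain ⟨a, q, rfl, -⟩ := h
  simp [Headless]

theorem next_congr (hl : leaves M .right l = leaves M .right l')
    (hr : leaves M .left r = leaves M .left r') : next M l c r = next M l' c r' := by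
  simp only [next, hl, hr]

end Cell

variable [Inhabited Γ]

namespace PosCfg

/-- The configuration one step later; a halted configuration does not change. -/
def next (M : TM0.Machine Γ Λ) (p : PosCfg Γ Λ) : PosCfg Γ Λ :=
  match M p.cfg.q p.cfg.Tape.head with
  | none => p
  | some (q, .write a) => ⟨⟨q, p.cfg.Tape.write a⟩, p.pos⟩
  | some (q, .move .right) => ⟨⟨q, p.cfg.Tape.move .right⟩, p.pos + 1⟩
  | some (q, .move .left) => ⟨⟨q, p.cfg.Tape.move .left⟩, p.pos - 1⟩

/-- The cell at position `i`. -/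
noncomputable def cell (p : PosCfg Γ Λ) (i : ℤ) : Cell Γ Λ :=
  some (p.cfg.Tape.nth (i - p.pos), if i = p.pos then some p.cfg.q else none)

variable {M : TM0.Machine Γ Λ}

theorem iterate_next_cfg (p : PosCfg Γ Λ) (r : ℕ) :
    ((next M)^[r] p).cfg = (fun c => (TM0.step M c).getD c)^[r] p.cfg := by
  refine Function.Semiconj.iterate_right (fun p => ?_) r p
  simp only [next, TM0.step]
  rcases M p.cfg.q p.cfg.Tape.head with _ | ⟨q', (_ | _) | a⟩ <;> rfl

theorem abs_next_pos_sub_le (p : PosCfg Γ Λ) : |(p.next M).pos - p.pos| ≤ 1 := by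
  simp only [next]
  rcases M p.cfg.q p.cfg.Tape.head with _ | ⟨q', (_ | _) | a⟩ <;> simp

theorem abs_iterate_next_pos_sub_le (p : PosCfg Γ Λ) (r : ℕ) :
    |((next M)^[r] p).pos - p.pos| ≤ r := by
  induction r with
  | zero => simp
  | succ r ih =>
    rw [Function.iterate_succ_apply', Nat.cast_succ, add_comm (r : ℤ)]
    exact (abs_sub_le _ _ _).trans (add_le_add (abs_next_pos_sub_le _) ih)

theorem halted_cell_iff (p : PosCfg Γ Λ) (i : ℤ) :
    (p.cell i).Halted M ↔ i = p.pos ∧ TM0.step M p.cfg = none := by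
  by_cases h : i = p.pos <;> simp [Cell.Halted, cell, TM0.step, h]

omit [Inhabited Λ] in
theorem headless_cell {p : PosCfg Γ Λ} {i : ℤ} (h : i ≠ p.pos) : (p.cell i).Headless := by
  simp [Cell.Headless, cell, h]

theorem next_cell_of_eq_pos (p : PosCfg Γ Λ) (l r : Cell Γ Λ) :
    Cell.next M l (p.cell p.pos) r = (p.next M).cell p.pos := by
  have hcell : p.cell p.pos = some (p.cfg.Tape.head, some p.cfg.q) := by simp [cell]
  simp only [hcell, Cell.next, next]
  rcases M p.cfg.q p.cfg.Tape.head with _ | ⟨q', (_ | _) | a⟩ <;>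
    simp [cell, Tape.move_left_nth, Tape.move_right_nth, Tape.write,
      (sub_one_lt p.pos).ne']

theorem next_cell_of_ne_pos {p : PosCfg Γ Λ} {i : ℤ} (h : i ≠ p.pos) (l r : Cell Γ Λ) :
    Cell.next M l (p.cell i) r = some (p.cfg.Tape.nth (i - p.pos),
      (Cell.leaves M .right l).or (Cell.leaves M .left r)) := by
  have hcell : p.cell i = some (p.cfg.Tape.nth (i - p.pos), none) := by simp [cell, h]
  rw [hcell]
  rfl

theorem cell_next_of_ne_pos {p : PosCfg Γ Λ} {i : ℤ} (h : i ≠ p.pos) :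
    (p.next M).cell i = some (p.cfg.Tape.nth (i - p.pos),
      (Cell.leaves M .right (p.cell (i - 1))).or (Cell.leaves M .left (p.cell (i + 1)))) := by
  have hleaves (d : Dir) (j : ℤ) : Cell.leaves M d (p.cell j) =
      if j = p.pos then Cell.leaves M d (some (p.cfg.Tape.head, some p.cfg.q)) else none := by
    split_ifs with hj
    · simp [hj, cell]
    · exact (headless_cell hj).leaves_eq_none d
  have hl : i - (p.pos - 1) - 1 = i - p.pos := by ring
  have hr : i - (p.pos + 1) + 1 = i - p.pos := by ring
  rw [hleaves, hleaves, next]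
  rcases hM : M p.cfg.q p.cfg.Tape.head with _ | ⟨q', (_ | _) | a⟩
  · simp [Cell.leaves, hM, cell, h]
  · simp [Cell.leaves, hM, cell, Tape.move_left_nth, hl, eq_sub_iff_add_eq]
  · simp [Cell.leaves, hM, cell, Tape.move_right_nth, hr, sub_eq_iff_eq_add]
  · simp [Cell.leaves, hM, cell, Tape.write_nth, sub_eq_zero, h]

theorem next_cell (p : PosCfg Γ Λ) (i : ℤ) :
    Cell.next M (p.cell (i - 1)) (p.cell i) (p.cell (i + 1)) = (p.next M).cell i := by
  obtain rfl | h := eq_or_ne i p.pos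
  · exact next_cell_of_eq_pos p _ _
  · rw [next_cell_of_ne_pos h, cell_next_of_ne_pos h]

/-- The cell at position `i` of a row which has separators at the positions `0` and `k`. -/
noncomputable def rowCell (k : ℕ) (p : PosCfg Γ Λ) (i : ℕ) : Cell Γ Λ :=
  if i = 0 ∨ i = k then none else p.cell i

variable {k : ℕ} {p : PosCfg Γ Λ}

theorem leaves_rowCell (hpos : 0 < p.pos ∧ p.pos < k) (d : Dir) (i : ℕ) :
    Cell.leaves M d (p.rowCell k i) = Cell.leaves M d (p.cell i) := by
  rw [rowCell]
  split_ifs with hi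
  · exact ((headless_cell (by omega)).leaves_eq_none d).symm
  · rfl

omit [Inhabited Λ] in
theorem headless_rowCell (hpos : ¬ (0 < p.pos ∧ p.pos < k)) {i : ℕ} (hi : i ≤ k) :
    (p.rowCell k i).Headless := by
  rw [rowCell]
  split_ifs with h
  · simp [Cell.Headless]
  · exact headless_cell (by omega)

theorem next_rowCell (hpos : 0 < p.pos ∧ p.pos < k) {i : ℕ} (hi : i < k) {r : Cell Γ Λ}
    (hr : i + 1 < k → r = p.rowCell k (i + 2)) :
    Cell.next M (p.rowCell k i) (p.rowCell k (i + 1)) r = (p.next M).rowCell k (i + 1) := by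
  obtain rfl | h := eq_or_lt_of_le (Nat.succ_le_of_lt hi)
  · simp [rowCell, Cell.next]
  · have hcell (q : PosCfg Γ Λ) : q.rowCell k (i + 1) = q.cell (i + 1 : ℕ) :=
      if_neg (by omega)
    rw [hr h, hcell, hcell, ← next_cell]
    refine Cell.next_congr ?_ ?_
    · rw [leaves_rowCell hpos, Nat.cast_succ, add_sub_cancel_right]
    · rw [leaves_rowCell hpos]
      rfl

end PosCfg

/-- Up to the index `N`, the sequence `z` of cells is a space-time diagram of the machine, written
row by row; neighbouring rows share a separator, and the rows start at the multiples of `k`. -/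
def IsDiagram (M : TM0.Machine Γ Λ) (k N : ℕ) (z : ℕ → Cell Γ Λ) : Prop :=
  ∀ j, j + k + 1 ≤ N → z (j + k + 1) = Cell.next M (z j) (z (j + 1)) (z (j + 2))

namespace IsDiagram

variable {M : TM0.Machine Γ Λ} {k N : ℕ} {z : ℕ → Cell Γ Λ} {p : PosCfg Γ Λ}

omit [Inhabited Γ] in
theorem headless_of_row (hz : IsDiagram M k N z) (hk : 1 < k) {s : ℕ}
    (hrow : ∀ i ≤ k, s + i ≤ N → (z (s + i)).Headless) {j : ℕ} (hs : s ≤ j) (hj : j ≤ N) :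
    (z j).Headless := by
  induction j using Nat.strong_induction_on with
  | _ j ih =>
    obtain h | h := le_or_gt j (s + k)
    · obtain ⟨i, rfl⟩ := Nat.exists_eq_add_of_le hs
      exact hrow i (by omega) hj
    · obtain ⟨i, rfl⟩ := Nat.exists_eq_add_of_le' h
      have hnext := hz (s + i) (by omega)
      rw [show s + i + k + 1 = i + (s + k).succ by omega] at hnext
      rw [hnext]
      exact .next (ih _ (by omega) (by omega) (by omega)) (ih _ (by omega) (by omega) (by omega))
        (ih _ (by omega) (by omega) (by omega))

theorem eq_rowCell (hz : IsDiagram M k N z) (hk : 1 < k) (hN : ¬ (z N).Headless)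
    (hfirst : ∀ i ≤ k, z i = p.rowCell k i) (r : ℕ) {i : ℕ} (hi : i ≤ k) (hr : r * k + i ≤ N) :
    z (r * k + i) = ((PosCfg.next M)^[r] p).rowCell k i := by
  induction r generalizing i with
  | zero => simpa using hfirst i hi
  | succ r ih =>
    rw [Nat.succ_mul] at hr ⊢
    rw [Function.iterate_succ_apply']
    obtain _ | i := i
    · simpa [PosCfg.rowCell] using ih le_rfl (by omega)
    · have hpos : 0 < ((PosCfg.next M)^[r] p).pos ∧ ((PosCfg.next M)^[r] p).pos < k := by
        by_contra hpos
        refine hN (hz.headless_of_row hk (s := r * k) (fun i hi hr => ?_) (by omega) le_rfl)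
        exact ih hi hr ▸ PosCfg.headless_rowCell hpos hi
      have hnext := hz (r * k + i) (by omega)
      rw [ih (by omega) (by omega), add_assoc (r * k) i 1, ih hi (by omega), add_assoc (r * k) i 2,
        PosCfg.next_rowCell hpos hi fun h => ih h (by omega)] at hnext
      rw [← hnext]
      congr 1
      omega

theorem exists_step_eq_none (hz : IsDiagram M k N z) (hk : 1 < k) (hN : (z N).Halted M)
    (hfirst : ∀ i ≤ k, z i = p.rowCell k i) :
    ∃ r, TM0.step M ((PosCfg.next M)^[r] p).cfg = none := by
  have hlast := hz.eq_rowCell hk hN.not_headless hfirst (N / k) (Nat.mod_lt N (by omega)).le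
    (Nat.div_add_mod' N k).le
  rw [Nat.div_add_mod'] at hlast
  rw [hlast, PosCfg.rowCell] at hN
  split_ifs at hN
  · simp [Cell.Halted] at hN
  · exact ⟨_, ((PosCfg.halted_cell_iff _ _).1 hN).2⟩

end IsDiagram

namespace PosCfg

/-- The space-time diagram of the machine started at `p`, cut off to rows of width `k`. -/
noncomputable def diagram (M : TM0.Machine Γ Λ) (k : ℕ) (p : PosCfg Γ Λ) (j : ℕ) : Cell Γ Λ :=
  ((next M)^[j / k] p).rowCell k (j % k)

variable {M : TM0.Machine Γ Λ} {k N : ℕ} {p : PosCfg Γ Λ}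

theorem diagram_mul_add (hk : 0 < k) (r : ℕ) {i : ℕ} (hi : i ≤ k) :
    p.diagram M k (r * k + i) = ((next M)^[r] p).rowCell k i := by
  obtain rfl | hi := hi.eq_or_lt
  · rw [← Nat.succ_mul]
    simp [diagram, rowCell]
  · rw [diagram, Nat.mul_add_mod', Nat.mod_eq_of_lt hi, Nat.mul_comm, Nat.mul_add_div hk,
      Nat.div_eq_of_lt hi, add_zero]

theorem isDiagram_diagram (hk : 0 < k)
    (hpos : ∀ r, r * k ≤ N → 0 < ((next M)^[r] p).pos ∧ ((next M)^[r] p).pos < k) :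
    IsDiagram M k N (p.diagram M k) := by
  intro j hj
  obtain ⟨r, i, hi, rfl⟩ : ∃ r i, i < k ∧ r * k + i = j :=
    ⟨j / k, j % k, Nat.mod_lt j hk, Nat.div_add_mod' j k⟩
  rw [show r * k + i + k + 1 = (r + 1) * k + (i + 1) by ring, diagram_mul_add hk _ hi,
    diagram_mul_add hk _ hi.le, add_assoc, diagram_mul_add hk _ hi, Function.iterate_succ_apply']
  exact (next_rowCell (hpos r (by omega)) hi fun h => diagram_mul_add hk r h).symm

theorem exists_isDiagram {p : PosCfg Γ Λ} {R : ℕ} (hR : TM0.step M ((next M)^[R] p).cfg = none)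
    (hpos : ∀ r ≤ R, 0 < ((next M)^[r] p).pos ∧ ((next M)^[r] p).pos < k) :
    ∃ z N, R * k ≤ N ∧ (∀ i ≤ k, z i = p.rowCell k i) ∧ IsDiagram M k N z ∧ (z N).Halted M := by
  obtain ⟨h₀, hk⟩ := hpos R le_rfl
  obtain ⟨i, hi⟩ := Int.eq_ofNat_of_zero_le h₀.le
  have hk₀ : 0 < k := by omega
  refine ⟨p.diagram M k, R * k + i, by omega, fun i hi => ?_,
    isDiagram_diagram hk₀ fun r hr => hpos r ?_, ?_⟩
  · simpa using diagram_mul_add (M := M) (p := p) hk₀ 0 hi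
  · refine Nat.lt_succ_iff.1 (Nat.lt_of_mul_lt_mul_right (a := k) ?_)
    rw [Nat.succ_mul]
    omega
  · rw [diagram_mul_add hk₀ R (by omega), rowCell, if_neg (by omega)]
    exact (halted_cell_iff _ _).2 ⟨hi.symm, hR⟩

end PosCfg

theorem eval_dom_iff_exists_isDiagram (M : TM0.Machine Γ Λ) (c : TM0.Cfg Γ Λ) (n : ℕ) :
    (StateTransition.eval (TM0.step M) c).Dom ↔ ∃ (a b N : ℕ) (z : ℕ → Cell Γ Λ),
      a + n + b + 2 ≤ N ∧
      (∀ i ≤ a + n + b + 2, z i = (⟨c, a + 1⟩ : PosCfg Γ Λ).rowCell (a + n + b + 2) i) ∧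
      IsDiagram M (a + n + b + 2) N z ∧ (z N).Halted M := by
  constructor
  · intro h
    obtain ⟨r, hr⟩ := eval_dom_iff_exists_iterate.1 h
    let p : PosCfg Γ Λ := ⟨c, (r + 1 : ℕ) + 1⟩
    have hhalt : TM0.step M ((PosCfg.next M)^[r + 1] p).cfg = none := by
      rw [PosCfg.iterate_next_cfg, Function.iterate_succ_apply', hr]
      exact hr
    have hpos (s : ℕ) (hs : s ≤ r + 1) : 0 < ((PosCfg.next M)^[s] p).pos ∧
        ((PosCfg.next M)^[s] p).pos < ((r + 1) + n + (r + 1) + 2 : ℕ) := by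
      have h := abs_le.1 (PosCfg.abs_iterate_next_pos_sub_le (M := M) p s)
      simp only [p] at h ⊢
      omega
    obtain ⟨z, N, hN, hz⟩ := PosCfg.exists_isDiagram hhalt hpos
    exact ⟨r + 1, r + 1, N, z, (Nat.le_mul_of_pos_left _ r.succ_pos).trans hN, hz⟩
  · rintro ⟨a, b, N, z, -, hfirst, hz, hN⟩
    obtain ⟨r, hr⟩ := hz.exists_step_eq_none (by omega) hN hfirst
    exact eval_dom_iff_exists_iterate.2 ⟨r, by rwa [PosCfg.iterate_next_cfg] at hr⟩

end SpaceTime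

namespace BlockAutomaton

/-- The automaton with the states `0, …, m` that starts in `s` and has the step function `f`, whose
values are taken modulo `m + 1`. -/
def ofNat {B : Type} (m s : ℕ) (f : ℕ → B → Option ℕ) : BlockAutomaton B (Fin (m + 1)) where
  start := Fin.ofNat (m + 1) s
  step q a := (f q a).map (Fin.ofNat (m + 1))

variable {B W : Type}

theorem ofNat_step_map_val {m s : ℕ} {f : ℕ → B → Option ℕ} {q : Fin (m + 1)} {a : B}
    (h : ∀ j ∈ f q a, j ≤ m) : ((ofNat m s f).step q a).map Fin.val = f q a := by
  rw [ofNat, Option.map_map]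
  exact Option.map_congr (fun j hj => Nat.mod_eq_of_lt (Nat.lt_succ_of_le (h j hj))) |>.trans
    Option.map_id'

theorem reads_map {B' W' : Type} {R : BlockAutomaton B W} {R' : BlockAutomaton B' W'} {φ : W → W'}
    {g : B → B'} (h : ∀ q a, R'.step (φ q) (g a) = (R.step q a).map φ) {q : W} {u : List B} :
    R'.Reads (φ q) (u.map g) ↔ R.Reads q u := by
  induction u generalizing q with
  | nil => rfl
  | cons a u ih =>
    rw [List.map_cons, Reads, Reads, h]
    cases R.step q a with
    | none => exact List.map_eq_nil_iff
    | some q' => exact ih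

variable {R : BlockAutomaton B W}

theorem not_reads_of_forall_step_eq {d : W} (hd : ∀ c, R.step d c = some d) (u : List B) :
    ¬ R.Reads d u := by
  induction u with
  | nil => exact id
  | cons c u ih => simpa only [Reads, hd] using ih

variable [DecidableEq B] {q d : W} {x y : B}

theorem reads_iff_of_expect {q' : W} (hd : ∀ c, R.step d c = some d)
    (h : ∀ c, R.step q c = some (if c = x then q' else d)) {u : List B} :
    R.Reads q u ↔ ∃ v, u = x :: v ∧ R.Reads q' v := by
  obtain _ | ⟨c, u⟩ := u
  · simp [Reads]
  by_cases hc : c = x <;> simp [Reads, h, hc, not_reads_of_forall_step_eq hd]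

theorem reads_iff_of_skip {t : Option W} (hd : ∀ c, R.step d c = some d) (hxy : x ≠ y)
    (h : ∀ c, R.step q c = if c = y then t else some (if c = x then q else d)) {u : List B} :
    R.Reads q u ↔ ∃ b v, u = List.replicate b x ++ y :: v ∧ t.elim (v = []) (R.Reads · v) := by
  induction u with
  | nil => simp [Reads]
  | cons c u ih =>
    rw [← Nat.or_exists_add_one]
    obtain rfl | hy := eq_or_ne c y
    · cases t <;> simp [Reads, h, List.replicate_succ, hxy.symm]
    obtain rfl | hx := eq_or_ne c x
    · simp [Reads, h, hy, List.replicate_succ, ih]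
    · simp [Reads, h, hy, hx, List.replicate_succ, not_reads_of_forall_step_eq hd]

end BlockAutomaton

section FirstRow

open Turing

variable {Γ Λ : Type} [Inhabited Γ] [Inhabited Λ] {X Y : Γ} {n : ℕ}

/-- The first row of the diagram for the input `n`: between the separators there are `X` with the
head, `n` symbols `Y`, and blanks. -/
def firstRow (X Y : Γ) (a n b : ℕ) : List (Cell Γ Λ) :=
  none :: (List.replicate a (some (default, none)) ++ some (X, some default) ::
    (List.replicate n (some (Y, none)) ++ (List.replicate b (some (default, none)) ++ [none])))

open Classical in
/-- Reads a row `firstRow X Y a n b` from the state `1`: the state `2` is in front of the head, the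
states `3, …, n + 2` count the symbols `Y`, the state `n + 3` is behind them, and `0` is a sink. -/
noncomputable def rowStep (X Y : Γ) (n i : ℕ) (c : Cell Γ Λ) : Option ℕ :=
  if i = n + 3 then
    if c = none then none else some (if c = some (default, none) then n + 3 else 0)
  else if i = 2 then
    if c = some (X, some default) then some 3 else some (if c = some (default, none) then 2 else 0)
  else some (if i = 1 ∧ c = none ∨ 2 < i ∧ i < n + 3 ∧ c = some (Y, none) then i + 1 else 0)

theorem rowStep_le (i : ℕ) (c : Cell Γ Λ) : ∀ j ∈ rowStep X Y n i c, j ≤ n + 3 := by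
  rw [rowStep]
  split_ifs <;> simp only [Option.mem_def, Option.some.injEq, reduceCtorEq, forall_eq',
    IsEmpty.forall_iff, implies_true] <;> omega

/-- The automaton with the step function `rowStep`, before its states are cut off. -/
noncomputable def rowReader (X Y : Γ) (n : ℕ) : BlockAutomaton (Cell Γ Λ) ℕ where
  start := 1
  step := rowStep X Y n

theorem rowReader_step_zero (c : Cell Γ Λ) : (rowReader X Y n).step 0 c = some 0 := by
  simp [rowReader, rowStep]

theorem reads_rowReader_of_add_eq {m i : ℕ} (hi : 2 < i) (hm : i + m = n + 3)
    {u : List (Cell Γ Λ)} :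
    (rowReader X Y n).Reads i u ↔ ∃ b, u =
      List.replicate m (some (Y, none)) ++ (List.replicate b (some (default, none)) ++ [none]) := by
  classical
  induction m generalizing i u with
  | zero =>
    rw [BlockAutomaton.reads_iff_of_skip (x := some (default, none)) (y := none) (t := none)
      rowReader_step_zero (by simp) (by simp [rowReader, rowStep, ← hm])]
    simp
  | succ m ih =>
    have hstep (c : Cell Γ Λ) : (rowReader X Y n).step i c =
        some (if c = some (Y, none) then i + 1 else 0) := by
      simp [rowReader, rowStep, hi, show i ≠ n + 3 ∧ i ≠ 2 ∧ i ≠ 1 ∧ i < n + 3 by omega]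
    simp only [BlockAutomaton.reads_iff_of_expect rowReader_step_zero hstep,
      ih (hi.trans i.lt_succ_self) (by omega)]
    constructor
    · rintro ⟨_, rfl, b, rfl⟩
      exact ⟨b, rfl⟩
    · rintro ⟨b, rfl⟩
      exact ⟨_, rfl, b, rfl⟩

theorem reads_rowReader_iff {u : List (Cell Γ Λ)} :
    (rowReader X Y n).Reads 1 u ↔ ∃ a b, u = firstRow X Y a n b := by
  classical
  have hstep_one (c : Cell Γ Λ) :
      (rowReader X Y n).step 1 c = some (if c = none then 2 else 0) := by
    simp [rowReader, rowStep]
  have hstep_two (c : Cell Γ Λ) : (rowReader X Y n).step 2 c =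
      if c = some (X, some default) then some 3
      else some (if c = some (default, none) then 2 else 0) := by
    simp [rowReader, rowStep]
  simp only [BlockAutomaton.reads_iff_of_expect rowReader_step_zero hstep_one,
    BlockAutomaton.reads_iff_of_skip rowReader_step_zero (by simp) hstep_two, Option.elim_some,
    reads_rowReader_of_add_eq (show 2 < 3 by simp) (Nat.add_comm 3 n)]
  constructor
  · rintro ⟨_, rfl, a, _, rfl, b, rfl⟩
    exact ⟨a, b, rfl⟩
  · rintro ⟨a, b, rfl⟩
    exact ⟨_, rfl, a, _, rfl, b, rfl⟩

theorem reads_ofNat_rowStep_iff {B : Type} (cell : B → Cell Γ Λ) {u : List B} :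
    (BlockAutomaton.ofNat (n + 3) 1 fun i a => rowStep X Y n i (cell a)).Reads
      (Fin.ofNat _ 1) u ↔ ∃ a b, u.map cell = firstRow X Y a n b := by
  rw [← reads_rowReader_iff (Λ := Λ),
    ← BlockAutomaton.reads_map (R' := rowReader X Y n) (φ := Fin.val) (g := cell)]
  · simp
  · exact fun q a => (BlockAutomaton.ofNat_step_map_val (s := 1) (rowStep_le _ _)).symm

omit [Inhabited Λ] in
theorem nth_mk₁_cons_replicate (i : ℤ) : (Tape.mk₁ (X :: List.replicate n Y)).nth i =
    if i = 0 then X else if 0 < i ∧ i ≤ n then Y else default := by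
  obtain (_ | i) | i := i
  · rfl
  · change List.getI (X :: List.replicate n Y) (i + 1) = _
    simp only [List.getI_eq_getElem?_getD, List.getElem?_cons_succ, List.getElem?_replicate,
      Int.ofNat_eq_natCast, Nat.cast_add, Nat.cast_one]
    split_ifs <;> first | rfl | omega
  · simp only [Int.negSucc_ne_zero, ↓reduceIte, Int.negSucc_not_pos, false_and]
    rfl

theorem firstRow_eq_map_rowCell (a b : ℕ) : firstRow X Y a n b =
    (List.range (a + n + b + 3)).map (PosCfg.rowCell (Λ := Λ) (a + n + b + 2)
      ⟨TM0.init (X :: List.replicate n Y), a + 1⟩) := by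
  refine List.ext_getElem (by simp [firstRow]; omega) fun i hi hi' => ?_
  simp only [List.length_map, List.length_range] at hi'
  simp only [firstRow, List.getElem_cons, List.getElem_append, List.length_replicate,
    List.getElem_replicate, List.getElem_map, List.getElem_range, PosCfg.rowCell, PosCfg.cell,
    TM0.init, nth_mk₁_cons_replicate]
  split_ifs <;> first | rfl | omega

end FirstRow

section Windows

variable {C : Type}

/-- The word of the windows of length three at the positions `0, …, N - 1` of a sequence. -/
def windows (z : ℕ → C) (N : ℕ) : List (C × C × C) :=
  (List.range N).map fun j => (z j, z (j + 1), z (j + 2))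

theorem windows_succ (z : ℕ → C) (N : ℕ) :
    windows z (N + 1) = (z 0, z 1, z 2) :: windows (fun j => z (j + 1)) N := by
  simp [windows, List.range_succ_eq_map, Function.comp_def]

theorem isChain_windows (z : ℕ → C) (N : ℕ) :
    (windows z N).IsChain fun a b => a.2.1 = b.1 ∧ a.2.2 = b.2.1 := by
  simp [List.isChain_iff_getElem, windows]

theorem exists_eq_windows {w : List (C × C × C)} (hne : w ≠ [])
    (h : w.IsChain fun a b => a.2.1 = b.1 ∧ a.2.2 = b.2.1) : ∃ z, w = windows z w.length := by
  induction w with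
  | nil => exact (hne rfl).elim
  | cons a w ih =>
    obtain _ | ⟨b, w⟩ := w
    · exact ⟨fun j => [a.1, a.2.1].getD j a.2.2, rfl⟩
    · obtain ⟨hab, hw⟩ := List.isChain_cons_cons.1 h
      obtain ⟨z, hz⟩ := ih (List.cons_ne_nil _ _) hw
      refine ⟨fun j => j.casesOn a.1 z, ?_⟩
      have hb := (List.cons.inj (hz.trans (windows_succ z w.length))).1
      subst hb
      rw [List.length_cons, windows_succ]
      exact congrArg₂ List.cons (Prod.ext rfl (Prod.ext hab.1 hab.2)) hz

theorem windows_add (z : ℕ → C) (m l : ℕ) :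
    windows z (m + l) = windows z m ++ windows (fun j => z (m + j)) l := by
  simp [windows, List.range_add, Function.comp_def, add_assoc]

theorem windows_eq_append_iff {z : ℕ → C} {N : ℕ} {u v : List (C × C × C)} :
    windows z N = u ++ v ↔
      ∃ m l, N = m + l ∧ u = windows z m ∧ v = windows (fun j => z (m + j)) l := by
  constructor
  · intro h
    have hlen : N = u.length + v.length := by simpa [windows] using congrArg List.length h
    rw [hlen, windows_add] at h
    obtain ⟨hu, hv⟩ := List.append_inj h (by simp [windows])
    exact ⟨_, _, hlen, hu.symm, hv.symm⟩
  · rintro ⟨m, l, rfl, rfl, rfl⟩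
    exact windows_add z m l

theorem forall_mem_zip_windows {z z' : ℕ → C} {m n : ℕ} {r : (C × C × C) × (C × C × C) → Prop} :
    (∀ p ∈ (windows z m).zip (windows z' n), r p) ↔ ∀ j < m, j < n →
      r ((z j, z (j + 1), z (j + 2)), (z' j, z' (j + 1), z' (j + 2))) := by
  simp only [List.mem_iff_getElem]
  constructor
  · intro h j hm hn
    exact h _ ⟨j, by simp [windows, hm, hn], by simp [windows]⟩
  · rintro h _ ⟨j, hj, rfl⟩
    simp only [windows, List.length_zip, List.length_map, List.length_range, lt_inf_iff] at hj
    simpa [windows] using h j hj.1 hj.2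

end Windows

section DiagramTest

open Turing

variable {Γ Λ : Type} [Inhabited Λ]

/-- The pullback of a test along a map of the letters. -/
def DelayTest.comap {B B' : Type} (S : DelayTest B) (g : B' → B) : DelayTest B' where
  adj a b := S.adj (g a) (g b)
  rel a b := S.rel (g a) (g b)
  final a := S.final (g a)

theorem DelayTest.passes_comap {B B' W W' : Type} {S : DelayTest B} {R : BlockAutomaton B W}
    {R' : BlockAutomaton B' W'} {g : B' → B} {w : List B'}
    (hR : ∀ u, R'.Reads R'.start u ↔ R.Reads R.start (u.map g)) :
    (S.comap g).Passes R' w ↔ S.Passes R (w.map g) := by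
  have hfinal : (∃ a ∈ w.getLast?, S.final (g a)) ↔ ∃ b ∈ (w.map g).getLast?, S.final b := by
    simp
  have hdelay : (∃ u v, w = u ++ v ∧ R'.Reads R'.start u ∧
      ∀ p ∈ w.zip v, S.rel (g p.1) (g p.2)) ↔ ∃ u v, w.map g = u ++ v ∧ R.Reads R.start u ∧
      ∀ p ∈ (w.map g).zip v, S.rel p.1 p.2 := by
    simp only [hR, List.map_eq_append_iff]
    constructor
    · rintro ⟨u, v, rfl, hu, h⟩
      refine ⟨_, _, ⟨u, v, rfl, rfl, rfl⟩, hu, ?_⟩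
      rw [List.zip_map]
      exact List.forall_mem_map.2 h
    · rintro ⟨_, _, ⟨u, v, rfl, rfl, rfl⟩, hu, h⟩
      exact ⟨u, v, rfl, hu, List.forall_mem_map.1 (by rwa [List.zip_map] at h)⟩
  rw [Passes, Passes, List.isChain_map, ← hfinal, ← hdelay]
  rfl

/-- Tests whether a word of windows of cells is a diagram that ends at a halted cell, when the
delay is the distance of a cell to the right neighbour of the same cell in the next row. -/
def diagramTest (M : TM0.Machine Γ Λ) : DelayTest (Cell Γ Λ × Cell Γ Λ × Cell Γ Λ) where
  adj a b := a.2.1 = b.1 ∧ a.2.2 = b.2.1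
  rel a b := b.1 = Cell.next M a.1 a.2.1 a.2.2
  final a := a.1.Halted M

variable [Inhabited Γ]

theorem map_fst_windows_eq_firstRow_iff {X Y : Γ} {z : ℕ → Cell Γ Λ} {m a n b : ℕ} :
    (windows z m).map Prod.fst = firstRow X Y a n b ↔ m = a + n + b + 3 ∧ ∀ i < m, z i =
      (⟨TM0.init (X :: List.replicate n Y), a + 1⟩ : PosCfg Γ Λ).rowCell (a + n + b + 2) i := by
  rw [firstRow_eq_map_rowCell, windows, List.map_map]
  constructor
  · intro h
    obtain rfl : m = a + n + b + 3 := by simpa using congrArg List.length h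
    exact ⟨rfl, fun i hi => List.map_inj_left.1 h i (List.mem_range.2 hi)⟩
  · rintro ⟨rfl, h⟩
    exact List.map_inj_left.2 fun i hi => h i (List.mem_range.1 hi)

omit [Inhabited Γ] in
theorem forall_mem_zip_windows_iff_isDiagram {M : TM0.Machine Γ Λ} {z : ℕ → Cell Γ Λ} {k l : ℕ} :
    (∀ p ∈ (windows z (k + 1 + l)).zip (windows (fun j => z (k + 1 + j)) l),
      (diagramTest M).rel p.1 p.2) ↔ IsDiagram M k (k + l) z := by
  simp only [forall_mem_zip_windows, diagramTest, IsDiagram]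
  constructor
  · intro h j hj
    rw [add_assoc, add_comm j]
    exact h j (by omega) (by omega)
  · intro h j _ hj
    rw [← h j (by omega), add_comm (k + 1), add_assoc]

theorem passes_windows_iff {W : Type} {M : TM0.Machine Γ Λ} {X Y : Γ} {n N : ℕ} {z : ℕ → Cell Γ Λ}
    {R : BlockAutomaton (Cell Γ Λ × Cell Γ Λ × Cell Γ Λ) W}
    (hR : ∀ u, R.Reads R.start u ↔ ∃ a b, u.map Prod.fst = firstRow X Y a n b) :
    (diagramTest M).Passes R (windows z (N + 1)) ↔ ∃ a b, a + n + b + 2 ≤ N ∧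
      (∀ i ≤ a + n + b + 2, z i =
        (⟨TM0.init (X :: List.replicate n Y), a + 1⟩ : PosCfg Γ Λ).rowCell (a + n + b + 2) i) ∧
      IsDiagram M (a + n + b + 2) N z ∧ (z N).Halted M := by
  have hlast : (∃ c ∈ (windows z (N + 1)).getLast?, c.1.Halted M) ↔ (z N).Halted M := by
    simp [windows, List.range_succ]
  constructor
  · rintro ⟨⟨-, hN⟩, u, v, huv, hu, hz⟩
    obtain ⟨m, l, hl, rfl, rfl⟩ := windows_eq_append_iff.1 huv
    obtain ⟨a, b, h⟩ := (hR _).1 hu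
    obtain ⟨rfl, hfirst⟩ := map_fst_windows_eq_firstRow_iff.1 h
    obtain rfl : N = a + n + b + 2 + l := by omega
    rw [hl] at hz
    exact ⟨a, b, by omega, fun i hi => hfirst i (by omega),
      forall_mem_zip_windows_iff_isDiagram.1 hz, hlast.1 hN⟩
  · rintro ⟨a, b, hle, hfirst, hz, hN⟩
    obtain ⟨l, rfl⟩ := Nat.exists_eq_add_of_le hle
    have hl : a + n + b + 2 + l + 1 = a + n + b + 2 + 1 + l := by omega
    refine ⟨⟨isChain_windows z _, hlast.2 hN⟩, _, _,
      windows_eq_append_iff.2 ⟨_, _, hl, rfl, rfl⟩, (hR _).2 ⟨a, b, ?_⟩, ?_⟩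
    · exact map_fst_windows_eq_firstRow_iff.2 ⟨rfl, fun i hi => hfirst i (by omega)⟩
    · rw [hl]
      exact forall_mem_zip_windows_iff_isDiagram.2 hz

theorem exists_passes_iff {B : Type} (M : TM0.Machine Γ Λ) (X Y : Γ) (n : ℕ)
    (e : B ≃ Cell Γ Λ × Cell Γ Λ × Cell Γ Λ) :
    (∃ w, ((diagramTest M).comap e).Passes
      (.ofNat (n + 3) 1 fun i a => rowStep X Y n i (e a).1) w) ↔
      (StateTransition.eval (TM0.step M) (TM0.init (X :: List.replicate n Y))).Dom := by
  let R : BlockAutomaton (Cell Γ Λ × Cell Γ Λ × Cell Γ Λ) _ :=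
    .ofNat (n + 3) 1 fun i c => rowStep X Y n i c.1
  have hR : ∀ u, R.Reads R.start u ↔ ∃ a b, u.map Prod.fst = firstRow X Y a n b :=
    fun u => reads_ofNat_rowStep_iff Prod.fst
  have hcomap (w : List B) := DelayTest.passes_comap (S := diagramTest M) (R := R)
    (R' := .ofNat (n + 3) 1 fun i a => rowStep X Y n i (e a).1) (g := e) (w := w)
    fun u => by rw [hR, List.map_map]; exact reads_ofNat_rowStep_iff fun a => (e a).1
  rw [eval_dom_iff_exists_isDiagram _ _ n]
  constructor
  · rintro ⟨w, hw⟩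
    rw [hcomap] at hw
    have hne : w ≠ [] := by
      rintro rfl
      simp [DelayTest.Passes] at hw
    obtain ⟨N, hN⟩ := Nat.exists_eq_succ_of_ne_zero (List.length_eq_zero_iff.not.2 hne)
    obtain ⟨z, hz⟩ := exists_eq_windows (List.map_eq_nil_iff.not.2 hne) hw.1.1
    rw [List.length_map, hN] at hz
    rw [hz, passes_windows_iff hR] at hw
    obtain ⟨a, b, h⟩ := hw
    exact ⟨a, b, N, z, h⟩
  · rintro ⟨a, b, N, z, h⟩
    refine ⟨(windows z (N + 1)).map e.symm, ?_⟩
    rw [hcomap, List.map_map, e.self_comp_symm, List.map_id]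
    exact (passes_windows_iff hR).2 ⟨a, b, h⟩

end DiagramTest

/-! ### Computability of the descriptions -/

section Descriptions

variable {b k : ℕ} {α β : Type}

/-- The list of the codes of the successors, in the order of the labels, public labels first. -/
def LabelledMove.codes (code : α → ℕ × ℕ) : LabelledMove (Fin b ⊕ Fin k) α → List (ℕ × ℕ)
  | .single t => [code t]
  | .choice f => (List.ofFn fun g => code (f (.inl g))) ++ List.ofFn fun d => code (f (.inr d))

theorem PAFA.describeU_map {nC nP : ℕ} (e : α ↪ Fin nC × Fin nP)
    (x : LabelledMove (Fin b ⊕ Fin k) α) :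
    PAFA.describeU (x.map e) = x.codes fun t => ((e t).1, (e t).2) := by
  cases x <;> rfl

namespace DelayTest

section Map

variable {B W W' : Type} (S : DelayTest B) {R : BlockAutomaton B W} {R' : BlockAutomaton B W'}
  {φ : W → W'} (g₀ : B)

theorem next_map (h : ∀ q a, R'.step (φ q) a = (R.step q a).map φ) (c : Option B) (m : Mode B W)
    (a : Option B) :
    S.next R' g₀ c (m.map id φ) a = (S.next R g₀ c m a).map id (Sum.map id φ) := by
  rcases c with _ | c <;> rcases m with (_ | _ | _ | _) | q <;> rcases a with _ | a
  case some.inr.some =>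
    simp only [next, Sum.map_inr, h]
    cases R.step q a <;> rfl
  all_goals first | rfl | (simp only [next, Sum.map_inl, id_eq]; split_ifs <;> rfl)

theorem opening_map (hstart : φ R.start = R'.start) (l : B ⊕ Fin 2) :
    opening R' l = (opening R l).map id (Sum.map id φ) := by
  rcases l with g | d
  · rfl
  · fin_cases d
    · rfl
    · exact congrArg (fun q => ((none, .inr q) : Option B × Mode B W')) hstart.symm

theorem codes_move_map {S : DelayTest (Fin b)} {R : BlockAutomaton (Fin b) W}
    {R' : BlockAutomaton (Fin b) W'} {g₀ : Fin b} (hstart : φ R.start = R'.start)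
    (h : ∀ q a, R'.step (φ q) a = (R.step q a).map φ)
    (code : Option (Fin b) × Mode (Fin b) W' → ℕ × ℕ) (c : Option (Fin b)) (m : Mode (Fin b) W)
    (a : Option (Fin b)) : (S.move R' g₀ c (m.map id φ) a).codes code =
      (S.move R g₀ c m a).codes (code ∘ Prod.map id (Sum.map id φ)) := by
  have hnext := congrArg (fun t => [code t]) (S.next_map g₀ h c m a)
  rcases c with _ | c <;> rcases m with (_ | _ | _ | _) | _
  case none.inl.idle =>
    have hopening (l) := congrArg code (opening_map hstart l)
    exact congrArg₂ _ (congrArg _ (funext fun g => hopening (.inl g)))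
      (congrArg _ (funext fun d => hopening (.inr d)))
  all_goals exact hnext

end Map

/-- The numbering of the private state components that do not belong to the block automaton. -/
noncomputable def taskEquiv (b : ℕ) : Task (Fin b) ≃ Fin (Nat.card (Task (Fin b))) :=
  Finite.equivFin _

/-- The numbering of the private state components: first the tasks, then the states of the block
automaton. -/
noncomputable def modeEquiv (b m : ℕ) :
    Mode (Fin b) (Fin m) ≃ Fin (Nat.card (Task (Fin b)) + m) :=
  ((taskEquiv b).sumCongr (Equiv.refl _)).trans finSumFinEquiv

/-- The numbers of the two components of a state. -/
noncomputable def code (s : Option (Fin b) × Mode (Fin b) ℕ) : ℕ × ℕ :=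
  ((finSuccEquiv b).symm s.1,
    s.2.elim (fun t => taskEquiv b t) fun i => Nat.card (Task (Fin b)) + i)

theorem code_map_val {m : ℕ} (s : Option (Fin b) × Mode (Fin b) (Fin m)) :
    code (s.map id (Sum.map id Fin.val)) =
      (((finSuccEquiv b).symm s.1 : ℕ), (modeEquiv b m s.2 : ℕ)) := by
  rcases s with ⟨c, t | q⟩ <;> simp [code, modeEquiv]

theorem primrec_ofFn_modeEquiv_symm [Primcodable α] {m : ℕ → ℕ} (hm : Primrec m)
    {F : ℕ → Mode (Fin b) ℕ → α} (hF : ∀ t, Primrec fun n => F n (.inl t))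
    (hF' : Primrec₂ fun n i => F n (.inr i)) :
    Primrec fun n => List.ofFn fun p : Fin (Nat.card (Task (Fin b)) + m n) =>
      F n (((modeEquiv b (m n)).symm p).map id Fin.val) := by
  refine (Primrec.list_append.comp (Primrec.list_ofFn fun i => hF ((taskEquiv b).symm i))
    (Primrec.list_map (Primrec.list_range.comp hm) hF')).of_eq fun n => ?_
  have htask (i : Fin (Nat.card (Task (Fin b)))) :
      finSumFinEquiv.symm (Fin.castLE (Nat.le_add_right _ (m n)) i) = .inl i :=
    finSumFinEquiv_symm_apply_castAdd i
  simp [List.ofFn_add, modeEquiv, htask, List.ofFn_eq_map, ← List.map_coe_finRange_eq_range]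

variable [Nontrivial (Fin b)] (S : DelayTest (Fin b)) (g₀ : Fin b)

/-- The automaton for a test with numbered state components. -/
noncomputable def numberedAutomaton {m : ℕ} (R : BlockAutomaton (Fin b) (Fin m)) :
    PAFA (Fin (b + 1)) (Fin (Nat.card (Task (Fin b)) + m)) (Fin b) (Fin b) (Fin 2) :=
  (S.automaton R g₀).reindex (finSuccEquiv b).symm (modeEquiv b m)

theorem mem_language_numberedAutomaton_iff {m : ℕ} {R : BlockAutomaton (Fin b) (Fin m)}
    {w : List (Fin b)} : w ∈ (S.numberedAutomaton g₀ R).language ↔ S.Passes R w := by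
  rw [numberedAutomaton, PAFA.language_reindex, mem_language_iff]

theorem describeU_numberedAutomaton {m : ℕ} {R : BlockAutomaton (Fin b) (Fin m)}
    {R' : BlockAutomaton (Fin b) ℕ} (hstart : R.start = R'.start)
    (h : ∀ (q : Fin m) a, R'.step q a = (R.step q a).map Fin.val)
    (c : Fin (b + 1)) (p : Fin (Nat.card (Task (Fin b)) + m)) (a : Option (Fin b)) :
    PAFA.describeU ((S.numberedAutomaton g₀ R).deltaU c p a) =
      (S.move R' g₀ (finSuccEquiv b c) (((modeEquiv b m).symm p).map id Fin.val) a).codes code := by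
  rw [codes_move_map (φ := Fin.val) hstart h]
  exact (PAFA.describeU_map _ _).trans <|
    congrArg (LabelledMove.codes · _) (funext fun s => (code_map_val s).symm)

omit [Nontrivial (Fin b)] in
theorem primrec_codes_move_inl {s : ℕ} (f : ℕ → ℕ → Fin b → Option ℕ) (c : Option (Fin b))
    (t : Task (Fin b)) (a : Option (Fin b)) :
    Primrec fun n => (S.move ⟨s, f n⟩ g₀ c (.inl t) a).codes code := by
  have h (n) : S.move ⟨s, f 0⟩ g₀ c (.inl t) a = S.move ⟨s, f n⟩ g₀ c (.inl t) a := by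
    rcases c with _ | c <;> rcases t with _ | _ | _ | _ <;> rcases a with _ | a <;> rfl
  exact (Primrec.const _).of_eq fun n => congrArg _ (h n)

omit [Nontrivial (Fin b)] in
theorem primrec_codes_move_inr {s : ℕ} {f : ℕ → ℕ → Fin b → Option ℕ}
    (hf : ∀ a, Primrec₂ fun n i => f n i a) (c : Option (Fin b)) (a : Option (Fin b)) :
    Primrec₂ fun n i => (S.move ⟨s, f n⟩ g₀ c (.inr i) a).codes code := by
  have hcode {γ : Type} [Primcodable γ] (c : Option (Fin b)) {i : γ → ℕ} (hi : Primrec i) :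
      Primrec fun x => [code (c, (.inr (i x) : Mode (Fin b) ℕ))] :=
    Primrec.list_cons.comp (Primrec.pair (Primrec.const ((finSuccEquiv b).symm c : ℕ))
      (Primrec.nat_add.comp (Primrec.const _) hi)) (Primrec.const [])
  rcases c with _ | c
  · exact hcode (some g₀) Primrec.snd
  · rcases a with _ | a
    · exact Primrec.const [code (none, (.inl .dead : Mode (Fin b) ℕ))]
    · refine (Primrec.option_casesOn (hf a)
        (Primrec.const [code (none, (.inl .compare : Mode (Fin b) ℕ))])
        (hcode none Primrec.snd).to₂).of_eq fun x => ?_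
      simp only [move, next, LabelledMove.codes]
      cases f x.1 x.2 a <;> rfl

theorem primrec_describe_numberedAutomaton {m : ℕ → ℕ} (hm : Primrec m) {s : ℕ}
    (hs : ∀ n, s ≤ m n) {f : ℕ → ℕ → Fin b → Option ℕ} (hf : ∀ a, Primrec₂ fun n i => f n i a)
    (hfm : ∀ n i a, ∀ j ∈ f n i a, j ≤ m n) :
    Primrec fun n => (S.numberedAutomaton g₀ (.ofNat (m n) s (f n))).describe := by
  have hm' : Primrec fun n => m n + 1 := Primrec.succ.comp hm
  have hU (n c p a) := S.describeU_numberedAutomaton g₀ (R := .ofNat (m n) s (f n))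
    (R' := ⟨s, f n⟩) (Nat.mod_eq_of_lt (Nat.lt_succ_of_le (hs n)))
    (fun q a => (BlockAutomaton.ofNat_step_map_val (hfm n q a)).symm) c p a
  simp only [PAFA.describe, hU]
  refine Primrec.pair ?_ (Primrec.pair (Primrec.list_ofFn fun c => ?_) (Primrec.pair ?_
    (Primrec.pair (Primrec.list_ofFn fun c => ?_) ?_)))
  · exact Primrec.pair (Primrec.const _) (Primrec.pair
      (Primrec.nat_add.comp (Primrec.const _) hm') (Primrec.const _))
  · refine (primrec_ofFn_modeEquiv_symm (b := b) hm'
      (F := fun _ p => (finSuccEquiv b c).isSome || !p.isReciting)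
      (fun t => Primrec.const _) (Primrec₂.const ((finSuccEquiv b c).isSome || true))).of_eq
      fun n => congrArg _ (funext fun p => ?_)
    change (_ || _) = (_ || !((modeEquiv b (m n + 1)).symm p).isReciting)
    rcases (modeEquiv b (m n + 1)).symm p with (_ | _ | _ | _) | _ <;> rfl
  · exact Primrec.const
      (List.ofFn fun c => PAFA.describeE ((S.numberedAutomaton g₀ (.ofNat (m 0) s (f 0))).deltaE c))
  · exact primrec_ofFn_modeEquiv_symm hm'
      (F := fun n p => (S.move ⟨s, f n⟩ g₀ _ p none).codes code ::
        List.ofFn fun a => (S.move ⟨s, f n⟩ g₀ _ p (some a)).codes code)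
      (fun t => Primrec.list_cons.comp (S.primrec_codes_move_inl g₀ f _ t none)
        (Primrec.list_ofFn fun a => S.primrec_codes_move_inl g₀ f _ t (some a)))
      (Primrec.list_cons.comp (S.primrec_codes_move_inr g₀ hf _ none)
        (Primrec.list_ofFn fun a => S.primrec_codes_move_inr g₀ hf _ (some a)))
  · refine (Primrec.const ((((finSuccEquiv b).symm none : Fin (b + 1)) : ℕ),
      (taskEquiv b .idle : ℕ), (((finSuccEquiv b).symm (some g₀) : Fin (b + 1)) : ℕ),
      (((finSuccEquiv b).symm none : Fin (b + 1)) : ℕ))).of_eq fun n => ?_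
    simp [numberedAutomaton, automaton, PAFA.reindex, modeEquiv]

end DelayTest

theorem primrec_rowStep {Γ Λ : Type} [Inhabited Γ] [Inhabited Λ] (X Y : Γ) (c : Cell Γ Λ) :
    Primrec₂ fun n i => rowStep X Y n i c := by
  classical
  have hconst (p : Prop) : PrimrecPred fun _ : ℕ × ℕ => p := (Primrec.const (decide p)).primrecPred
  have heq (j : ℕ) : PrimrecPred fun x : ℕ × ℕ => x.2 = j :=
    Primrec.eq.comp Primrec.snd (Primrec.const j)
  have hn : Primrec fun x : ℕ × ℕ => x.1 + 3 := Primrec.nat_add.comp Primrec.fst (Primrec.const 3)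
  have hgt : PrimrecPred fun x : ℕ × ℕ => 2 < x.2 :=
    Primrec.nat_lt.comp (Primrec.const 2) Primrec.snd
  have hlt : PrimrecPred fun x : ℕ × ℕ => x.2 < x.1 + 3 := Primrec.nat_lt.comp Primrec.snd hn
  have hcond := ((heq 1).and (hconst (c = none))).or
    (hgt.and (hlt.and (hconst (c = some (Y, none)))))
  have hend := Primrec.ite (hconst (c = none)) (Primrec.const (none : Option ℕ))
    (Primrec.option_some.comp (Primrec.ite (hconst (c = some (default, none))) hn
      (Primrec.const 0)))
  have hhead := Primrec.const (α := ℕ × ℕ) (if c = some (X, some default) then some 3 else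
    some (if c = some (default, none) then 2 else 0))
  have hcount := Primrec.option_some.comp
    (Primrec.ite hcond (Primrec.succ.comp Primrec.snd) (Primrec.const 0))
  refine (Primrec.ite (Primrec.eq.comp Primrec.snd hn) hend
    (Primrec.ite (heq 2) hhead hcount)).of_eq fun x => ?_
  simp only [rowStep]

end Descriptions

/-- The emptiness problem for realtime private alternating finite automata is undecidable: no
computable predicate on finite descriptions holds, among the descriptions of such automata, for
exactly those of the automata that recognize the empty language. -/
theorem mainTheorem2 :
    ¬ ∃ Q : PAFADescription → Prop, ComputablePred Q ∧
      ∀ (nC nP nA nG nD : ℕ) (M : PAFA (Fin nC) (Fin nP) (Fin nA) (Fin nG) (Fin nD)),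
        Q M.describe ↔ M.language = ∅ := by
  rintro ⟨Q, hQ, hempty⟩
  obtain ⟨Γ, Λ, _, _, _, _, M, X, Y, hM⟩ := exists_finite_machine_not_computablePred_dom
  let e := (Finite.equivFin (Cell Γ Λ × Cell Γ Λ × Cell Γ Λ)).symm
  have : Nontrivial (Fin _) := e.nontrivial
  let S := (diagramTest M).comap e
  let f (n i : ℕ) (a) := rowStep X Y n i (e a).1
  have hlanguage (n : ℕ) :
      (S.numberedAutomaton (e.symm default) (.ofNat (n + 3) 1 (f n))).language = ∅ ↔
        ¬ (StateTransition.eval (Turing.TM0.step M)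
          (Turing.TM0.init (X :: List.replicate n Y))).Dom := by
    rw [← exists_passes_iff M X Y n e, Set.eq_empty_iff_forall_notMem, not_exists]
    simp only [DelayTest.mem_language_numberedAutomaton_iff, S, f]
  have hdescribe := S.primrec_describe_numberedAutomaton (e.symm default) (m := (· + 3))
    (Primrec.nat_add.comp .id (.const 3)) (s := 1) (fun n => by omega) (f := f)
    (fun a => primrec_rowStep X Y (e a).1) (fun n i a => rowStep_le i (e a).1)
  have hred : ComputablePred fun n : ℕ =>
      ¬ (StateTransition.eval (Turing.TM0.step M)
          (Turing.TM0.init (X :: List.replicate n Y))).Dom :=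
    ComputablePred.computable_of_manyOneReducible
      ⟨_, hdescribe.to_comp, fun n => by rw [hempty, hlanguage]⟩ hQ
  exact hM (hred.not.of_eq fun n => not_not)
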